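/- \textbf{Lemma (steady-state tracking of constant references).} Let $A\in\mathbb R^{n\times n}$, $b,c,K\in\mathbb R^n$ be such that $A_m=A-bK^\top$ is Hurwitz, put $H_o(s)=(sI-A_m)^{-1}b$, assume $c^\top H_o(0)\neq 0$, and let $k_g=1/(c^\top H_o(0))$. Let $\Omega\subset\mathbb R^n$ be compact and convex, $\theta\in\Omega$, and $\theta_{\max}=\max_{\vartheta\in\Omega}\sum_i|\vartheta_i|$. Let $C(s)$ be the transfer function of a stable strictly proper single-input single-output system, i.e. $C(s)=\int_0^\infty e^{-st}h_C(t)\,dt$ for $\operatorname{Re}s\ge 0$ with a real impulse response $h_C\in L^1(0,\infty)$ (in particular, any stable strictly proper rational function), with $C(0)=1$. Let $Q$ be symmetric positive definite, let $P$ solve $A_m^\top P+PA_m=-Q$, let $\Gamma_c>0$, $x_0\in\mathbb R^n$, $\hat\theta_0\in\Omega$. For a single-input system $H$ with $n$ outputs whose components $H_i$ have impulse responses $h_i$, put $\|H\|_{\mathcal L_1}=\max_i\int_0^\infty|h_i(t)|\,dt$. Assume the $\mathcal L_1$-gain condition $$\|\bar G\|_{\mathcal L_1}\,\theta_{\max}<1,\qquad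 \bar G(s)=H_o(s)\,(C(s)-1).$$ For a constant reference $r\in\mathbb R$, consider on $[0,\infty)$ any solution of the closed loop consisting of the plant and control law $$\dot x=Ax+b\,(u-\theta^\top x),\quad x(0)=x_0,\quad y=c^\top x,\qquad u=-K^\top x+u_2,$$ the state predictor $$\dot{\hat x}=A_m\hat x-b\,\hat\theta^\top x+b\,u_2,\qquad \hat x(0)=x_0,$$ the adaptive law $$\dot{\hat\theta}=\Gamma_c\,\mathrm{Proj}\big(\hat\theta,\;x\,(\hat x-x)^\top Pb\big),\qquad \hat\theta(0)=\hat\theta_0,$$ understood in integrated form (Carathéodory solutions), where $\mathrm{Proj}(\hat\theta,v)$ is the Euclidean nearest-point projection of $v$ onto the tangent cone of $\Omega$ at $\hat\theta$, that is, onto the closure of $\{w:\hat\theta+\varepsilon w\in\Omega\text{ for some }\varepsilon>0\}$; and $$u_2(s)=C(s)\big(\bar r(s)+k_g r(s)\big),\qquad \bar r(t)=\hat\theta^\top(t)x(t),$$ i.e. $u_2(t)=\int_0^t h_C(t-\tau)\big(\bar r(\tau)+k_g r\big)\,d\tau$. Then $$\lim_{t\to\infty}y(t)=r.$$ -/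

import Mathlib

open scoped Matrix

namespace L1Adaptive

noncomputable section

/-- A real matrix is Hurwitz if all its complex eigenvalues have negative real part. -/
def IsHurwitz {n : ℕ} (M : Matrix (Fin n) (Fin n) ℝ) : Prop :=
  ∀ z ∈ spectrum ℂ (M.map (algebraMap ℝ ℂ)), z.re < 0

/-- `h` is the (integrable) impulse response of the single-input single-output system with
transfer function `H`: the Laplace transform of `h` is `H` on the closed right half-plane.
There is no direct feedthrough term, so these are the strictly proper systems. -/
def IsImpulseResponse (h : ℝ → ℝ) (H : ℂ → ℂ) : Prop :=
  MeasureTheory.IntegrableOn h (Set.Ioi 0) ∧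
    ∀ s : ℂ, 0 ≤ s.re → ∫ t in Set.Ioi (0 : ℝ), Complex.exp (-s * t) * (h t : ℂ) = H s

/-- A stable strictly proper single-input single-output system, given by its transfer function:
it has an integrable impulse response. -/
def IsStableStrictlyProper (H : ℂ → ℂ) : Prop :=
  ∃ h : ℝ → ℝ, IsImpulseResponse h H

/-- `u(s) = H(s) v(s)`: on `[0, ∞)` the signal `u` is the response of the system `H`, with zero
initial state, to the input `v`. -/
def IsResponse (H : ℂ → ℂ) (v u : ℝ → ℝ) : Prop :=
  ∃ h : ℝ → ℝ, IsImpulseResponse h H ∧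
    ∀ t : ℝ, 0 ≤ t → u t = ∫ τ in (0 : ℝ)..t, h (t - τ) * v τ

/-- The `L₁` gain `∫₀^∞ |h(t)| dt` of a system `H` with impulse response `h`. The impulse response
is unique up to a null set, so the infimum only selects it; the value is `∞` if there is none. -/
def l1Gain (H : ℂ → ℂ) : ENNReal :=
  ⨅ (h : ℝ → ℝ) (_ : IsImpulseResponse h H), ∫⁻ t in Set.Ioi (0 : ℝ), ENNReal.ofReal |h t|

/-- The `L₁` gain of a single-input `n`-output system: the maximum over the outputs. -/
def l1GainVec {n : ℕ} (H : ℂ → Fin n → ℂ) : ENNReal :=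
  ⨆ i, l1Gain (fun s => H s i)

/-- `A_m = A - b Kᵀ`. -/
def closedMatrix {n : ℕ} (A : Matrix (Fin n) (Fin n) ℝ) (b K : Fin n → ℝ) :
    Matrix (Fin n) (Fin n) ℝ :=
  A - Matrix.vecMulVec b K

/-- `H_o(s) = (s I - A_m)⁻¹ b`, for a real (`𝕜 = ℝ`) or complex (`𝕜 = ℂ`) argument `s`. -/
def Ho (𝕜 : Type) [Field 𝕜] [Algebra ℝ 𝕜] {n : ℕ} (Am : Matrix (Fin n) (Fin n) ℝ)
    (b : Fin n → ℝ) (s : 𝕜) : Fin n → 𝕜 :=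
  (s • (1 : Matrix (Fin n) (Fin n) 𝕜) - Am.map (algebraMap ℝ 𝕜))⁻¹ *ᵥ
    (fun i => algebraMap ℝ 𝕜 (b i))

/-- `Ḡ(s) = H_o(s) (C(s) - 1)`. -/
def Gbar {n : ℕ} (Am : Matrix (Fin n) (Fin n) ℝ) (b : Fin n → ℝ) (C : ℂ → ℂ) (s : ℂ) :
    Fin n → ℂ :=
  fun i => Ho ℂ Am b s i * (C s - 1)

/-- `k_g = 1 / (cᵀ H_o(0))`. -/
def kg {n : ℕ} (Am : Matrix (Fin n) (Fin n) ℝ) (b c : Fin n → ℝ) : ℝ :=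
  1 / (c ⬝ᵥ Ho ℝ Am b 0)

/-- `θ_max = max_{θ ∈ Ω} ∑ᵢ |θᵢ|`. -/
def thetaMax {n : ℕ} (Ω : Set (Fin n → ℝ)) : ENNReal :=
  ⨆ θ ∈ Ω, ∑ i, ENNReal.ofReal |θ i|

/-- The tangent cone at `θ` of a convex set `Ω`: the closure of the cone of feasible directions. -/
def tangentCone {n : ℕ} (Ω : Set (Fin n → ℝ)) (θ : Fin n → ℝ) : Set (Fin n → ℝ) :=
  closure {v | ∃ ε : ℝ, 0 < ε ∧ θ + ε • v ∈ Ω}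

/-- The projection operator `Proj(θ, y)` of the adaptive law: the point of the tangent cone of
`Ω` at `θ` that is nearest to `y` in the Euclidean norm. In particular it is `y` itself when `θ`
is an interior point of `Ω`. -/
def Proj {n : ℕ} (Ω : Set (Fin n → ℝ)) (θ y : Fin n → ℝ) : Fin n → ℝ :=
  Classical.epsilon fun v => v ∈ tangentCone Ω θ ∧
    ∀ w ∈ tangentCone Ω θ, (y - v) ⬝ᵥ (y - v) ≤ (y - w) ⬝ᵥ (y - w)

/-- The closed-loop system on `[0, ∞)`: the plant with state `x`, input `u` and output `y`, the
control law `u = -Kᵀx + u₂`, the state predictor `x̂`, the projection-based adaptive law for `θ̂`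
(in the sense of Carathéodory, its right-hand side being discontinuous) and the control signal
`u₂(s) = C(s) (r̄(s) + k_g r(s))`, `r̄ = θ̂ᵀ x`. -/
structure IsClosedLoop {n : ℕ} (A : Matrix (Fin n) (Fin n) ℝ) (b c K : Fin n → ℝ)
    (P : Matrix (Fin n) (Fin n) ℝ) (Γc : ℝ) (C : ℂ → ℂ) (Ω : Set (Fin n → ℝ))
    (θ x₀ θhat₀ : Fin n → ℝ) (r : ℝ → ℝ)
    (x xhat θhat : ℝ → Fin n → ℝ) (u u₂ y : ℝ → ℝ) : Prop where
  plant_init : x 0 = x₀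
  plant : ∀ t : ℝ, 0 ≤ t →
    HasDerivWithinAt x (A *ᵥ x t + (u t - θ ⬝ᵥ x t) • b) (Set.Ici 0) t
  output : ∀ t : ℝ, 0 ≤ t → y t = c ⬝ᵥ x t
  control : ∀ t : ℝ, 0 ≤ t → u t = -(K ⬝ᵥ x t) + u₂ t
  predictor_init : xhat 0 = x₀
  predictor : ∀ t : ℝ, 0 ≤ t →
    HasDerivWithinAt xhat
      (closedMatrix A b K *ᵥ xhat t - (θhat t ⬝ᵥ x t) • b + u₂ t • b) (Set.Ici 0) t
  adaptation_integrable : ∀ t : ℝ, 0 ≤ t →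
    IntervalIntegrable
      (fun τ => Γc • Proj Ω (θhat τ) (((xhat τ - x τ) ⬝ᵥ (P *ᵥ b)) • x τ))
      MeasureTheory.volume 0 t
  adaptation : ∀ t : ℝ, 0 ≤ t →
    θhat t = θhat₀ +
      ∫ τ in (0 : ℝ)..t, Γc • Proj Ω (θhat τ) (((xhat τ - x τ) ⬝ᵥ (P *ᵥ b)) • x τ)
  filter : IsResponse C (fun t => θhat t ⬝ᵥ x t + kg (closedMatrix A b K) b c * r t) u₂

end

end L1Adaptive

/-!
The state predictor makes the prediction error `e = x̂ - x` obey `ė = A_m e - b (θ̂ - θ)ᵀ x`. Along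
solutions `eᵀ P e + |θ̂ - θ|² / Γ_c` decreases at least at the rate `eᵀ Q e`, because the projection
can only speed up the decay; hence `e` and `θ̂` are bounded and `e` is square-integrable.

The mismatch `(θ̂ - θ)ᵀ x` passed through `H_o` gives `-e`, and convolutions commute, so its
filtered part inside `u₂` contributes `-C e` to the state. The state therefore solves
`x = Ḡ (θᵀ x) + H_o C (k_g r) - C e + e^{t A_m} x₀`. The gain condition makes this loop a
contraction, so `x` is bounded; then `ė` is bounded and Barbalat's argument gives `e → 0`. As
`Ḡ(0) = 0`, the loop has no effect on limits, and `x → H_o(0) k_g r`, that is, `cᵀ x → r`.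
-/

open MeasureTheory Set Filter Topology

namespace L1Adaptive

section BoundedSignals

variable {E F : Type*} [NormedAddCommGroup E] [NormedAddCommGroup F]

/-- Boundedness of a signal on the time axis `[0, ∞)`; its values at negative times are ignored. -/
def IsBoundedSignal (f : ℝ → E) : Prop :=
  ∃ M, ∀ t, 0 ≤ t → ‖f t‖ ≤ M

theorem IsBoundedSignal.add {f g : ℝ → E} (hf : IsBoundedSignal f) (hg : IsBoundedSignal g) :
    IsBoundedSignal fun t => f t + g t := by
  obtain ⟨M, hM⟩ := hf
  obtain ⟨N, hN⟩ := hg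
  exact ⟨M + N, fun t ht => norm_add_le_of_le (hM t ht) (hN t ht)⟩

theorem IsBoundedSignal.sub {f g : ℝ → E} (hf : IsBoundedSignal f) (hg : IsBoundedSignal g) :
    IsBoundedSignal fun t => f t - g t := by
  obtain ⟨M, hM⟩ := hf
  obtain ⟨N, hN⟩ := hg
  exact ⟨M + N, fun t ht => norm_sub_le_of_le (hM t ht) (hN t ht)⟩

theorem IsBoundedSignal.prodMk {f : ℝ → E} {g : ℝ → F} (hf : IsBoundedSignal f)
    (hg : IsBoundedSignal g) : IsBoundedSignal fun t => (f t, g t) := by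
  obtain ⟨M, hM⟩ := hf
  obtain ⟨N, hN⟩ := hg
  exact ⟨max M N, fun t ht => max_le_max (hM t ht) (hN t ht)⟩

theorem isBoundedSignal_pi {ι : Type*} [Fintype ι] {f : ℝ → ι → ℝ} :
    IsBoundedSignal f ↔ ∀ i, IsBoundedSignal fun t => f t i := by
  refine ⟨fun ⟨M, hM⟩ i => ⟨M, fun t ht => (norm_le_pi_norm (f t) i).trans (hM t ht)⟩, fun hf => ?_⟩
  choose M hM using hf
  refine ⟨∑ i, |M i|, fun t ht => (pi_norm_le_iff_of_nonneg (by positivity)).2 fun i => ?_⟩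
  calc ‖f t i‖ ≤ |M i| := (hM i t ht).trans (le_abs_self _)
    _ ≤ ∑ i, |M i| := Finset.single_le_sum (fun j _ => abs_nonneg (M j)) (Finset.mem_univ i)

theorem IsBoundedSignal.continuous_comp [ProperSpace E] {f : ℝ → E} {Φ : E → F}
    (hΦ : Continuous Φ) (hf : IsBoundedSignal f) : IsBoundedSignal fun t => Φ (f t) := by
  obtain ⟨M, hM⟩ := hf
  obtain ⟨N, hN⟩ :=
    (isCompact_closedBall (0 : E) M).exists_bound_of_continuousOn hΦ.continuousOn
  exact ⟨N, fun t ht => hN _ (mem_closedBall_zero_iff.2 (hM t ht))⟩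

theorem isBoundedSignal_of_tendsto {f : ℝ → E} {a : E} (hf : ContinuousOn f (Ici 0))
    (hlim : Tendsto f atTop (𝓝 a)) : IsBoundedSignal f := by
  obtain ⟨T, hT⟩ := eventually_atTop.1 (hlim.norm.eventually_le_const (lt_add_one ‖a‖))
  obtain ⟨M, hM⟩ :=
    isCompact_Icc.exists_bound_of_continuousOn (hf.mono (Icc_subset_Ici_self : Icc 0 T ⊆ _))
  refine ⟨max M (‖a‖ + 1), fun t ht => ?_⟩
  rcases le_total t T with htT | hTt
  · exact le_max_of_le_left (hM t ⟨ht, htT⟩)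
  · exact le_max_of_le_right (hT t hTt)

end BoundedSignals

section CausalConvolution

variable {f g h v w : ℝ → ℝ} {t M L : ℝ}

/-- The response at time `t` of the system with impulse response `h`, at rest at time `0`, to the
input `v`. -/
noncomputable def causalConv (h v : ℝ → ℝ) (t : ℝ) : ℝ :=
  ∫ τ in (0 : ℝ)..t, h (t - τ) * v τ

/-- The `L₁` norm on `[0, ∞)` of an impulse response. -/
noncomputable def l1Norm (h : ℝ → ℝ) : ℝ :=
  ∫ t in Ioi (0 : ℝ), |h t|

theorem l1Norm_nonneg (h : ℝ → ℝ) : 0 ≤ l1Norm h :=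
  integral_nonneg fun _ => abs_nonneg _

theorem causalConv_comm (h v : ℝ → ℝ) : causalConv h v = causalConv v h := by
  ext t
  have hsub := intervalIntegral.integral_comp_sub_left (a := 0) (b := t)
    (fun τ => h τ * v (t - τ)) t
  simp only [sub_sub_cancel, sub_self, sub_zero] at hsub
  simp only [causalConv, mul_comm (v _), hsub]

theorem causalConv_congr (ht : 0 ≤ t) (hvw : ∀ τ ∈ Icc 0 t, v τ = w τ) :
    causalConv h v t = causalConv h w t := by
  refine intervalIntegral.integral_congr fun τ hτ => ?_
  rw [uIcc_of_le ht] at hτ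
  simp only [hvw τ hτ]

theorem indicator_causalConv (h v : ℝ → ℝ) :
    (Ioi 0).indicator (causalConv h v) =
      convolution ((Ioi 0).indicator h) ((Ioi 0).indicator v) (ContinuousLinearMap.mul ℝ ℝ) := by
  rw [causalConv_comm, ← posConvolution_eq_convolution_indicator h v _ volume]
  unfold posConvolution causalConv
  simp only [ContinuousLinearMap.mul_apply', mul_comm (h _)]

theorem causalConv_eq_integral_Ioi (h v : ℝ → ℝ) (ht : 0 ≤ t) :
    causalConv h v t = ∫ τ in Ioi (0 : ℝ), h τ * (Ioi 0).indicator v (t - τ) := by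
  rcases ht.eq_or_lt with rfl | ht
  · refine (intervalIntegral.integral_same).trans (setIntegral_eq_zero_of_forall_eq_zero ?_).symm
    intro τ hτ
    rw [indicator_of_notMem (by simpa using le_of_lt hτ), mul_zero]
  · rw [← indicator_of_mem (mem_Ioi.2 ht) (causalConv h v), indicator_causalConv, convolution,
      ← integral_indicator measurableSet_Ioi]
    simp only [ContinuousLinearMap.mul_apply', indicator_mul_left]

theorem intervalIntegrable_causalConv_integrand (hh : IntegrableOn h (Ioi 0))
    (hv : ContinuousOn v (Ici 0)) (ht : 0 ≤ t) :
    IntervalIntegrable (fun τ => h (t - τ) * v τ) volume 0 t := by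
  have hshift : IntervalIntegrable (fun τ => h (t - τ)) volume 0 t := by
    have hIoc : IntervalIntegrable h volume 0 t :=
      (intervalIntegrable_iff_integrableOn_Ioc_of_le ht).2 (hh.mono_set Ioc_subset_Ioi_self)
    simpa using (hIoc.comp_sub_left t).symm
  refine hshift.mul_continuousOn (hv.mono ?_)
  rw [uIcc_of_le ht]
  exact Icc_subset_Ici_self

theorem causalConv_add (hh : IntegrableOn h (Ioi 0)) (hv : ContinuousOn v (Ici 0))
    (hw : ContinuousOn w (Ici 0)) (ht : 0 ≤ t) :
    causalConv h (fun τ => v τ + w τ) t = causalConv h v t + causalConv h w t := by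
  simp only [causalConv, mul_add]
  exact intervalIntegral.integral_add (intervalIntegrable_causalConv_integrand hh hv ht)
    (intervalIntegrable_causalConv_integrand hh hw ht)

theorem causalConv_neg (h v : ℝ → ℝ) (t : ℝ) :
    causalConv h (fun τ => -v τ) t = -causalConv h v t := by
  simp only [causalConv, mul_neg, intervalIntegral.integral_neg]

theorem causalConv_sub (hh : IntegrableOn h (Ioi 0)) (hv : ContinuousOn v (Ici 0))
    (hw : ContinuousOn w (Ici 0)) (ht : 0 ≤ t) :
    causalConv h (fun τ => v τ - w τ) t = causalConv h v t - causalConv h w t := by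
  simp only [sub_eq_add_neg, ← causalConv_neg]
  exact causalConv_add hh hv hw.neg ht

theorem causalConv_sub_left (hf : IntegrableOn f (Ioi 0)) (hg : IntegrableOn g (Ioi 0))
    (hv : ContinuousOn v (Ici 0)) (ht : 0 ≤ t) :
    causalConv (fun τ => f τ - g τ) v t = causalConv f v t - causalConv g v t := by
  simp only [causalConv, sub_mul]
  exact intervalIntegral.integral_sub (intervalIntegrable_causalConv_integrand hf hv ht)
    (intervalIntegrable_causalConv_integrand hg hv ht)

theorem integrableOn_causalConv (hf : IntegrableOn f (Ioi 0)) (hh : IntegrableOn h (Ioi 0)) :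
    IntegrableOn (causalConv f h) (Ioi 0) := by
  rw [← integrable_indicator_iff measurableSet_Ioi] at hf hh ⊢
  rw [indicator_causalConv]
  exact hf.integrable_convolution (ContinuousLinearMap.mul ℝ ℝ) hh

theorem causalConv_assoc_of_bounded (hf : IntegrableOn f (Ioi 0)) (hh : IntegrableOn h (Ioi 0))
    (hv : IntegrableOn v (Ioi 0)) (hM : ∀ τ, |v τ| ≤ M) (ht : 0 < t) :
    causalConv (causalConv f h) v t = causalConv f (causalConv h v) t := by
  rw [← indicator_of_mem (mem_Ioi.2 ht) (causalConv (causalConv f h) v),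
    ← indicator_of_mem (mem_Ioi.2 ht) (causalConv f _)]
  simp only [indicator_causalConv]
  rw [← integrable_indicator_iff measurableSet_Ioi] at hf hh hv
  set F := (Ioi (0 : ℝ)).indicator f
  set H := (Ioi (0 : ℝ)).indicator h
  set V := (Ioi (0 : ℝ)).indicator v
  set mul := ContinuousLinearMap.mul ℝ ℝ
  have hVM (s : ℝ) : ‖V s‖ ≤ M := (norm_indicator_le_norm_self _ _).trans (hM s)
  have hVshift : AEStronglyMeasurable (fun p : ℝ × ℝ => V (t - p.1)) (volume.prod volume) :=
    (hv.comp_sub_left t).aestronglyMeasurable.comp_fst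
  refine convolution_assoc' (L := mul) (L₂ := mul) (L₃ := mul) (L₄ := mul)
    (fun a b c => mul_assoc a b c) (hf.ae_convolution_exists mul hh)
    (hh.ae_convolution_exists mul hv) ?_
  refine ((hf.convolution_integrand mul hh).bdd_mul hVshift
    (Eventually.of_forall fun p => hVM _)).congr (Eventually.of_forall fun p => ?_)
  simp only [Function.uncurry, mul, ContinuousLinearMap.mul_apply']
  ring

theorem causalConv_assoc (hf : IntegrableOn f (Ioi 0)) (hh : IntegrableOn h (Ioi 0))
    (hv : ContinuousOn v (Ici 0)) (ht : 0 ≤ t) :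
    causalConv (causalConv f h) v t = causalConv f (causalConv h v) t := by
  rcases ht.eq_or_lt with rfl | ht₀
  · simp only [causalConv, intervalIntegral.integral_same]
  have hvt : ContinuousOn v (Icc 0 t) := hv.mono Icc_subset_Ici_self
  obtain ⟨M, hM⟩ := isCompact_Icc.exists_bound_of_continuousOn hvt
  set w := (Icc 0 t).indicator v with hw
  have hwM (τ : ℝ) : |w τ| ≤ M := by
    by_cases hτ : τ ∈ Icc 0 t
    · simpa only [hw, indicator_of_mem hτ, Real.norm_eq_abs] using hM τ hτ
    · simpa only [hw, indicator_of_notMem hτ, abs_zero] using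
        (norm_nonneg _).trans (hM 0 ⟨le_rfl, ht⟩)
  have hwi : IntegrableOn w (Ioi 0) :=
    ((integrable_indicator_iff measurableSet_Icc).2 (hvt.integrableOn_Icc)).integrableOn
  have hvw {k : ℝ → ℝ} {s : ℝ} (hs : s ∈ Icc 0 t) : causalConv k v s = causalConv k w s :=
    causalConv_congr hs.1 fun τ hτ =>
      (indicator_of_mem (show τ ∈ Icc 0 t from ⟨hτ.1, hτ.2.trans hs.2⟩) v).symm
  rw [hvw ⟨ht, le_rfl⟩, causalConv_assoc_of_bounded hf hh hwi hwM ht₀]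
  exact causalConv_congr ht fun s hs => (hvw hs).symm

theorem norm_mul_indicator_le (hM : ∀ τ ∈ Icc 0 t, |v τ| ≤ M) (ht : 0 ≤ t) {τ s : ℝ} (hτ : 0 ≤ τ)
    (hs : s ≤ t) : ‖h τ * (Ioi 0).indicator v (s - τ)‖ ≤ |h τ| * M := by
  rw [norm_mul, Real.norm_eq_abs, Real.norm_eq_abs]
  gcongr
  by_cases hpos : 0 < s - τ
  · simpa only [indicator_of_mem (mem_Ioi.2 hpos)] using hM (s - τ) ⟨hpos.le, by linarith⟩
  · rw [indicator_of_notMem (mt mem_Ioi.1 hpos), abs_zero]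
    exact (abs_nonneg _).trans (hM 0 ⟨le_rfl, ht⟩)

theorem abs_causalConv_le (hh : IntegrableOn h (Ioi 0)) (ht : 0 ≤ t)
    (hM : ∀ τ ∈ Icc 0 t, |v τ| ≤ M) : |causalConv h v t| ≤ l1Norm h * M := by
  rw [causalConv_eq_integral_Ioi h v ht, l1Norm, ← integral_mul_const, ← Real.norm_eq_abs]
  refine norm_integral_le_of_norm_le (Integrable.mul_const hh.abs M) ?_
  filter_upwards [ae_restrict_mem measurableSet_Ioi] with τ hτ
  exact norm_mul_indicator_le hM ht (le_of_lt hτ) le_rfl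

theorem IsBoundedSignal.causalConv (hh : IntegrableOn h (Ioi 0)) (hv : IsBoundedSignal v) :
    IsBoundedSignal (causalConv h v) := by
  obtain ⟨M, hM⟩ := hv
  exact ⟨l1Norm h * M, fun t ht => abs_causalConv_le hh ht fun τ hτ => hM τ hτ.1⟩

theorem aestronglyMeasurable_mul_indicator (hh : IntegrableOn h (Ioi 0))
    (hv : ContinuousOn v (Ici 0)) (t : ℝ) :
    AEStronglyMeasurable (fun τ => h τ * (Ioi 0).indicator v (t - τ)) (volume.restrict (Ioi 0)) :=
  have hvI : AEStronglyMeasurable ((Ioi 0).indicator v) :=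
    (aestronglyMeasurable_indicator_iff measurableSet_Ioi).2
      ((hv.mono Ioi_subset_Ici_self).aestronglyMeasurable measurableSet_Ioi)
  hh.aestronglyMeasurable.mul
    (hvI.comp_measurePreserving (Measure.measurePreserving_sub_left volume t)).restrict

theorem continuousOn_causalConv (hh : IntegrableOn h (Ioi 0)) (hv : ContinuousOn v (Ici 0)) :
    ContinuousOn (causalConv h v) (Ici 0) := by
  intro t ht
  obtain ⟨M, hM⟩ := isCompact_Icc.exists_bound_of_continuousOn
    (hv.mono (Icc_subset_Ici_self : Icc 0 (t + 1) ⊆ _))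
  have hdom : ContinuousWithinAt
      (fun s => ∫ τ in Ioi (0 : ℝ), h τ * (Ioi 0).indicator v (s - τ)) (Ici 0) t := by
    refine continuousWithinAt_of_dominated (bound := fun τ => |h τ| * M)
      (Eventually.of_forall fun s => aestronglyMeasurable_mul_indicator hh hv s) ?_
      (Integrable.mul_const hh.abs M) ?_
    · filter_upwards [mem_nhdsWithin_of_mem_nhds (Iic_mem_nhds (lt_add_one t))] with s hs
      filter_upwards [ae_restrict_mem measurableSet_Ioi] with τ hτ
      exact norm_mul_indicator_le hM (ht.trans (lt_add_one t).le) (le_of_lt hτ) hs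
    · have hne : ∀ᵐ τ : ℝ, τ ≠ t := by simp [ae_iff]
      filter_upwards [ae_restrict_of_ae hne] with τ hτ
      have hcont : ContinuousAt ((Ioi 0).indicator v) (t - τ) := by
        rcases (sub_ne_zero.2 hτ.symm).lt_or_gt with hneg | hpos
        · exact continuousAt_const.congr (Filter.mem_of_superset (Iio_mem_nhds hneg) fun s hs =>
            (indicator_of_notMem (notMem_Ioi.2 (le_of_lt hs)) v).symm)
        · exact (hv.continuousAt (Ici_mem_nhds hpos)).congr
            (Filter.mem_of_superset (Ioi_mem_nhds hpos) fun s hs => (indicator_of_mem hs v).symm)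
      exact (continuousAt_const.mul (hcont.comp (f := fun s => s - τ)
        (continuous_sub_right τ).continuousAt)).continuousWithinAt
  exact hdom.congr (fun s hs => causalConv_eq_integral_Ioi h v hs)
    (causalConv_eq_integral_Ioi h v ht)

theorem tendsto_causalConv (hh : IntegrableOn h (Ioi 0)) (hv : ContinuousOn v (Ici 0))
    (hlim : Tendsto v atTop (𝓝 L)) :
    Tendsto (causalConv h v) atTop (𝓝 ((∫ τ in Ioi (0 : ℝ), h τ) * L)) := by
  obtain ⟨M, hM⟩ := isBoundedSignal_of_tendsto hv hlim
  rw [← integral_mul_const]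
  refine (tendsto_integral_filter_of_dominated_convergence (fun τ => |h τ| * M)
    (Eventually.of_forall fun t => aestronglyMeasurable_mul_indicator hh hv t) ?_
    (Integrable.mul_const hh.abs M) (Eventually.of_forall fun τ => ?_)).congr' ?_
  · filter_upwards [eventually_ge_atTop 0] with t ht
    filter_upwards [ae_restrict_mem measurableSet_Ioi] with τ hτ
    exact norm_mul_indicator_le (fun s hs => hM s hs.1) ht (le_of_lt hτ) le_rfl
  · refine (hlim.comp (tendsto_atTop_add_const_right _ (-τ) tendsto_id)).const_mul (h τ)
      |>.congr' ?_
    filter_upwards [eventually_gt_atTop τ] with t ht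
    rw [indicator_of_mem (mem_Ioi.2 (sub_pos.2 ht))]
    rfl
  · filter_upwards [eventually_ge_atTop 0] with t ht
    exact (causalConv_eq_integral_Ioi h v ht).symm

theorem eventually_abs_causalConv_le (hh : IntegrableOn h (Ioi 0)) (hv : ContinuousOn v (Ici 0))
    (hM : ∀ᶠ τ in atTop, |v τ| ≤ M) {ε : ℝ} (hε : 0 < ε) :
    ∀ᶠ t in atTop, |causalConv h v t| ≤ l1Norm h * M + ε := by
  have hM0 : 0 ≤ M := hM.exists.elim fun τ hτ => (abs_nonneg _).trans hτ
  set w : ℝ → ℝ := fun τ => max (-M) (min M (v τ)) with hw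
  have hwc : ContinuousOn w (Ici 0) := continuousOn_const.sup (continuousOn_const.inf hv)
  have hwM (τ : ℝ) : |w τ| ≤ M := abs_le.2 ⟨le_max_left _ _, max_le (by linarith) (min_le_left _ _)⟩
  have hdiff : Tendsto (fun τ => v τ - w τ) atTop (𝓝 0) := by
    refine tendsto_const_nhds.congr' ?_
    filter_upwards [hM] with τ hτ
    simp only [hw, min_eq_right (abs_le.1 hτ).2, max_eq_right (abs_le.1 hτ).1, sub_self]
  have hdc : ContinuousOn (fun τ => v τ - w τ) (Ici 0) := hv.sub hwc
  have hsmall := tendsto_causalConv hh hdc hdiff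
  rw [mul_zero] at hsmall
  filter_upwards [eventually_ge_atTop 0, hsmall.abs.eventually_le_const (abs_zero.trans_lt hε)]
    with t ht hεt
  calc |causalConv h v t| = |causalConv h w t + causalConv h (fun τ => v τ - w τ) t| := by
        rw [← causalConv_add hh hwc hdc ht]
        simp only [add_sub_cancel]
    _ ≤ l1Norm h * M + ε :=
        (abs_add_le _ _).trans (add_le_add (abs_causalConv_le hh ht fun τ _ => hwM τ) hεt)

end CausalConvolution

section SmallGain

theorem tendsto_zero_of_eventual_contraction {α E : Type*} [NormedAddCommGroup E] {l : Filter α}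
    {e : α → E} {ρ : ℝ} (hρ₀ : 0 < ρ) (hρ₁ : ρ < 1) (hbdd : ∃ M, ∀ᶠ t in l, ‖e t‖ ≤ M)
    (hcontr : ∀ M > 0, (∀ᶠ t in l, ‖e t‖ ≤ M) → ∀ᶠ t in l, ‖e t‖ ≤ ρ * M) :
    Tendsto e l (𝓝 0) := by
  obtain ⟨M, hM⟩ := hbdd
  have hiter (k : ℕ) : ∀ᶠ t in l, ‖e t‖ ≤ ρ ^ k * max M 1 := by
    induction k with
    | zero => simpa only [pow_zero, one_mul] using hM.mono fun t ht => le_max_of_le_left ht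
    | succ k ih =>
      simpa only [pow_succ', mul_assoc] using hcontr _ (by positivity) ih
  have hgeom : Tendsto (fun k : ℕ => ρ ^ k * max M 1) atTop (𝓝 0) := by
    simpa only [zero_mul] using
      (tendsto_pow_atTop_nhds_zero_of_lt_one hρ₀.le hρ₁).mul_const (max M 1)
  refine NormedAddGroup.tendsto_nhds_zero.2 fun ε hε => ?_
  obtain ⟨k, hk⟩ := (hgeom.eventually_lt_const hε).exists
  exact (hiter k).mono fun t ht => ht.trans_lt hk

variable {ι : Type*} [Fintype ι] {θ : ι → ℝ} {g : ι → ℝ → ℝ} {x η : ℝ → ι → ℝ}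

theorem abs_dotProduct_le_sum_abs_mul_norm (θ v : ι → ℝ) : |θ ⬝ᵥ v| ≤ (∑ j, |θ j|) * ‖v‖ := by
  rw [dotProduct, Finset.sum_mul]
  refine (Finset.abs_sum_le_sum_abs _ _).trans (Finset.sum_le_sum fun j _ => ?_)
  rw [abs_mul]
  exact mul_le_mul_of_nonneg_left (norm_le_pi_norm v j) (abs_nonneg _)

theorem norm_l1Norm_mul_sum_lt_one (hgain : ∀ i, l1Norm (g i) * ∑ j, |θ j| < 1) :
    ‖fun i => l1Norm (g i) * ∑ j, |θ j|‖ < 1 := by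
  refine (pi_norm_lt_iff one_pos).2 fun i => ?_
  rw [Real.norm_of_nonneg (mul_nonneg (l1Norm_nonneg _) (by positivity))]
  exact hgain i

theorem l1Norm_mul_sum_mul_le (i : ι) {M : ℝ} (hM : 0 ≤ M) :
    l1Norm (g i) * ((∑ j, |θ j|) * M) ≤ ‖fun i => l1Norm (g i) * ∑ j, |θ j|‖ * M := by
  rw [← mul_assoc]
  refine mul_le_mul_of_nonneg_right ((le_abs_self _).trans ?_) hM
  exact norm_le_pi_norm (fun i => l1Norm (g i) * ∑ j, |θ j|) i

theorem isBoundedSignal_of_small_gain (hg : ∀ i, IntegrableOn (g i) (Ioi 0))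
    (hgain : ∀ i, l1Norm (g i) * ∑ j, |θ j| < 1) (hx : ContinuousOn x (Ici 0))
    (hloop : ∀ t, 0 ≤ t → ∀ i, x t i = causalConv (g i) (fun τ => θ ⬝ᵥ x τ) t + η t i)
    (hη : IsBoundedSignal η) : IsBoundedSignal x := by
  obtain ⟨D, hD⟩ := hη
  set γ := ‖fun i => l1Norm (g i) * ∑ j, |θ j|‖
  have hγ : γ < 1 := norm_l1Norm_mul_sum_lt_one hgain
  refine ⟨D / (1 - γ), fun T hT => ?_⟩
  obtain ⟨s, hs, hmax⟩ := isCompact_Icc.exists_isMaxOn ⟨T, hT, le_rfl⟩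
    ((hx.mono Icc_subset_Ici_self).norm (s := Icc 0 T))
  have hle (τ : ℝ) (hτ : τ ∈ Icc 0 s) : |θ ⬝ᵥ x τ| ≤ (∑ j, |θ j|) * ‖x s‖ := by
    refine (abs_dotProduct_le_sum_abs_mul_norm θ _).trans ?_
    gcongr
    exact hmax ⟨hτ.1, hτ.2.trans hs.2⟩
  have hs_le : ‖x s‖ ≤ γ * ‖x s‖ + D := by
    have hD₀ : 0 ≤ D := (norm_nonneg _).trans (hD s hs.1)
    refine (pi_norm_le_iff_of_nonneg (by positivity)).2 fun i => ?_
    calc ‖x s i‖ ≤ |causalConv (g i) (fun τ => θ ⬝ᵥ x τ) s| + ‖η s i‖ := by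
          rw [hloop s hs.1 i]; exact norm_add_le _ _
      _ ≤ γ * ‖x s‖ + D := add_le_add
          ((abs_causalConv_le (hg i) hs.1 hle).trans (l1Norm_mul_sum_mul_le i (norm_nonneg _)))
          ((norm_le_pi_norm (η s) i).trans (hD s hs.1))
  have hT_le : ‖x T‖ ≤ ‖x s‖ := hmax ⟨hT, le_rfl⟩
  rw [le_div_iff₀ (by linarith)]
  nlinarith

theorem tendsto_zero_of_small_gain (hg : ∀ i, IntegrableOn (g i) (Ioi 0))
    (hgain : ∀ i, l1Norm (g i) * ∑ j, |θ j| < 1) (hx : ContinuousOn x (Ici 0))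
    (hloop : ∀ t, 0 ≤ t → ∀ i, x t i = causalConv (g i) (fun τ => θ ⬝ᵥ x τ) t + η t i)
    (hxb : IsBoundedSignal x) (hη : Tendsto η atTop (𝓝 0)) : Tendsto x atTop (𝓝 0) := by
  set γ := ‖fun i => l1Norm (g i) * ∑ j, |θ j|‖
  have hγ₀ : 0 ≤ γ := norm_nonneg _
  have hγ : γ < 1 := norm_l1Norm_mul_sum_lt_one hgain
  have hθx : ContinuousOn (fun τ => θ ⬝ᵥ x τ) (Ici 0) :=
    (by fun_prop : Continuous fun v : ι → ℝ => θ ⬝ᵥ v).comp_continuousOn hx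
  obtain ⟨M₀, hM₀⟩ := hxb
  refine tendsto_zero_of_eventual_contraction (ρ := (1 + γ) / 2) (by linarith) (by linarith)
    ⟨M₀, (eventually_ge_atTop 0).mono hM₀⟩ fun M hM hxM => ?_
  have hε : 0 < (1 - γ) / 4 * M := mul_pos (by linarith) hM
  have hθM : ∀ᶠ τ in atTop, |θ ⬝ᵥ x τ| ≤ (∑ j, |θ j|) * M := by
    filter_upwards [hxM] with τ hτ
    refine (abs_dotProduct_le_sum_abs_mul_norm θ _).trans ?_
    gcongr
  have hconv : ∀ᶠ t in atTop, ∀ i,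
      |causalConv (g i) (fun τ => θ ⬝ᵥ x τ) t| ≤ γ * M + (1 - γ) / 4 * M :=
    eventually_all.2 fun i => (eventually_abs_causalConv_le (hg i) hθx hθM hε).mono fun t ht =>
      ht.trans (add_le_add_left (l1Norm_mul_sum_mul_le i hM.le) _)
  have hηε : ∀ᶠ t in atTop, ‖η t‖ ≤ (1 - γ) / 4 * M :=
    hη.norm.eventually_le_const (by rwa [norm_zero])
  filter_upwards [eventually_ge_atTop 0, hconv, hηε] with t ht hconv_t hη_t
  refine (pi_norm_le_iff_of_nonneg (by positivity)).2 fun i => ?_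
  calc ‖x t i‖ ≤ |causalConv (g i) (fun τ => θ ⬝ᵥ x τ) t| + ‖η t i‖ := by
        rw [hloop t ht i]; exact norm_add_le _ _
    _ ≤ (γ * M + (1 - γ) / 4 * M) + (1 - γ) / 4 * M :=
        add_le_add (hconv_t i) ((norm_le_pi_norm (η t) i).trans hη_t)
    _ = (1 + γ) / 2 * M := by ring

theorem tendsto_of_small_gain (hg : ∀ i, IntegrableOn (g i) (Ioi 0))
    (hg₀ : ∀ i, ∫ t in Ioi (0 : ℝ), g i t = 0)
    (hgain : ∀ i, l1Norm (g i) * ∑ j, |θ j| < 1) (hx : ContinuousOn x (Ici 0))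
    (hloop : ∀ t, 0 ≤ t → ∀ i, x t i = causalConv (g i) (fun τ => θ ⬝ᵥ x τ) t + η t i)
    (hxb : IsBoundedSignal x) {a : ι → ℝ} (hη : Tendsto η atTop (𝓝 a)) :
    Tendsto x atTop (𝓝 a) := by
  have hdiff : ContinuousOn (fun t => x t - a) (Ici 0) := hx.sub continuousOn_const
  have hθdiff : ContinuousOn (fun t => θ ⬝ᵥ (x t - a)) (Ici 0) :=
    (by fun_prop : Continuous fun v : ι → ℝ => θ ⬝ᵥ v).comp_continuousOn hdiff
  have hconst (i : ι) : Tendsto (causalConv (g i) fun _ => θ ⬝ᵥ a) atTop (𝓝 0) := by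
    simpa only [hg₀, zero_mul] using tendsto_causalConv (hg i) continuousOn_const tendsto_const_nhds
  refine tendsto_sub_nhds_zero_iff.1 (tendsto_zero_of_small_gain hg hgain hdiff
    (η := fun t i => causalConv (g i) (fun _ => θ ⬝ᵥ a) t + (η t i - a i)) ?_ ?_ ?_)
  · intro t ht i
    have hsplit := causalConv_add (hg i) hθdiff (continuousOn_const (c := θ ⬝ᵥ a)) ht
    simp only [dotProduct_sub, sub_add_cancel] at hsplit
    simp only [Pi.sub_apply, hloop t ht i, hsplit, dotProduct_sub]
    ring
  · exact hxb.sub ⟨‖a‖, fun _ _ => le_rfl⟩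
  · refine tendsto_pi_nhds.2 fun i => ?_
    simpa only [Pi.zero_apply, sub_self, add_zero] using
      (hconst i).add ((tendsto_pi_nhds.1 hη i).sub_const (a i))

end SmallGain

section MatrixExponential

attribute [local instance] Matrix.linftyOpNormedRing Matrix.linftyOpNormedAlgebra

variable {ι : Type*} [Fintype ι] [DecidableEq ι]

theorem exp_smul_mulVec_eq_sum {N : Matrix ι ι ℂ} {v : ι → ℂ} {k : ℕ} (hk : N ^ k *ᵥ v = 0)
    (t : ℝ) : NormedSpace.exp (t • N) *ᵥ v =
      ∑ j ∈ Finset.range k, t ^ j • (j.factorial : ℝ)⁻¹ • (N ^ j *ᵥ v) := by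
  let applyTo : Matrix ι ι ℂ →L[ℝ] ι → ℂ :=
    LinearMap.toContinuousLinearMap (((Matrix.mulVecBilin ℂ ℂ).flip v).restrictScalars ℝ)
  have happly (X : Matrix ι ι ℂ) : applyTo X = X *ᵥ v := rfl
  have hterm (j : ℕ) : applyTo ((j.factorial : ℝ)⁻¹ • (t • N) ^ j) =
      t ^ j • (j.factorial : ℝ)⁻¹ • (N ^ j *ᵥ v) := by
    rw [map_smul, smul_pow, map_smul, happly, smul_comm]
  have hvanish (j : ℕ) (hj : j ∉ Finset.range k) :
      applyTo ((j.factorial : ℝ)⁻¹ • (t • N) ^ j) = 0 := by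
    obtain ⟨m, rfl⟩ := Nat.exists_eq_add_of_le' (not_lt.1 (mt Finset.mem_range.2 hj))
    rw [hterm, pow_add N, ← Matrix.mulVec_mulVec, hk, Matrix.mulVec_zero, smul_zero, smul_zero]
  have hseries := applyTo.hasSum (NormedSpace.exp_series_hasSum_exp' (𝕂 := ℝ) (t • N))
  exact (hseries.unique (hasSum_sum_of_ne_finset_zero hvanish)).trans
    (Finset.sum_congr rfl fun j _ => hterm j)

theorem exp_smul_mulVec_eq_exp_smul (M : Matrix ι ι ℂ) (μ : ℂ) (v : ι → ℂ) (t : ℝ) :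
    NormedSpace.exp (t • M) *ᵥ v =
      Complex.exp (t * μ) • (NormedSpace.exp (t • (M - μ • 1)) *ᵥ v) := by
  have hsplit : t • M = algebraMap ℂ (Matrix ι ι ℂ) (t * μ) + t • (M - μ • 1) := by
    rw [Algebra.algebraMap_eq_smul_one, smul_sub, mul_smul, Complex.coe_smul, add_sub_cancel]
  have hscalar : NormedSpace.exp (algebraMap ℂ (Matrix ι ι ℂ) (t * μ)) =
      Complex.exp (t * μ) • (1 : Matrix ι ι ℂ) := by
    rw [Complex.exp_eq_exp_ℂ, ← Algebra.algebraMap_eq_smul_one]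
    exact (NormedSpace.algebraMap_exp_comm (t * μ : ℂ)).symm
  rw [hsplit, Matrix.exp_add_of_commute _ _ (Algebra.commute_algebraMap_left _ _), hscalar,
    smul_one_mul, Matrix.smul_mulVec]

/-- The vectors on which `t ↦ exp (t M)` decays exponentially as `t → ∞`. -/
def decaySubmodule (M : Matrix ι ι ℂ) : Submodule ℂ (ι → ℂ) where
  carrier := {v | ∃ α > 0,
    (fun t : ℝ => NormedSpace.exp (t • M) *ᵥ v) =O[atTop] fun t => Real.exp (-α * t)}
  zero_mem' := ⟨1, one_pos, by
    simpa only [Matrix.mulVec_zero] using Asymptotics.isBigO_zero _ _⟩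
  add_mem' := by
    rintro v w ⟨α, hα, hv⟩ ⟨β, hβ, hw⟩
    have hslower {γ δ : ℝ} (h : γ ≤ δ) :
        (fun t => Real.exp (-δ * t)) =O[atTop] fun t => Real.exp (-γ * t) :=
      Asymptotics.IsBigO.of_norm_eventuallyLE <| by
        filter_upwards [eventually_ge_atTop 0] with t ht
        rw [Real.norm_of_nonneg (Real.exp_pos _).le]
        gcongr
    refine ⟨min α β, lt_min hα hβ, ?_⟩
    simpa only [Matrix.mulVec_add] using
      (hv.trans (hslower (min_le_left α β))).add (hw.trans (hslower (min_le_right α β)))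
  smul_mem' := by
    rintro c v ⟨α, hα, hv⟩
    refine ⟨α, hα, (hv.const_smul_left c).congr_left fun t => ?_⟩
    exact (Matrix.mulVec_smul _ c v).symm

theorem mem_decaySubmodule_of_pow_mulVec_eq_zero {M : Matrix ι ι ℂ} {μ : ℂ} (hμ : μ.re < 0)
    {v : ι → ℂ} {k : ℕ} (hk : (M - μ • 1) ^ k *ᵥ v = 0) : v ∈ decaySubmodule M := by
  have hα : 0 < -μ.re / 2 := by linarith
  have hpoly : (fun t : ℝ => NormedSpace.exp (t • (M - μ • 1)) *ᵥ v) =O[atTop]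
      fun t => Real.exp (-μ.re / 2 * t) := by
    simp only [exp_smul_mulVec_eq_sum hk]
    refine Asymptotics.IsBigO.fun_sum fun j _ => ?_
    have hconst := Asymptotics.isBigO_const_const
      ((j.factorial : ℝ)⁻¹ • ((M - μ • 1) ^ j *ᵥ v)) (one_ne_zero (α := ℝ)) (atTop : Filter ℝ)
    simpa only [smul_eq_mul, mul_one] using
      (isLittleO_pow_exp_pos_mul_atTop j hα).isBigO.smul hconst
  have hexp : (fun t : ℝ => Complex.exp (t * μ)) =O[atTop] fun t => Real.exp (μ.re * t) :=
    Asymptotics.IsBigO.of_norm_le fun t => by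
      rw [Complex.norm_exp, Complex.re_ofReal_mul, mul_comm]
  refine ⟨-μ.re / 2, hα, ?_⟩
  simp only [exp_smul_mulVec_eq_exp_smul M μ]
  refine (hexp.smul hpoly).congr_right fun t => ?_
  rw [smul_eq_mul, ← Real.exp_add]
  ring_nf

theorem decaySubmodule_eq_top {M : Matrix ι ι ℂ} (hM : ∀ z ∈ spectrum ℂ M, z.re < 0) :
    decaySubmodule M = ⊤ := by
  rw [eq_top_iff, ← Module.End.iSup_maxGenEigenspace_eq_top (Matrix.toLinAlgEquiv' M)]
  refine iSup_le fun μ v hv => ?_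
  obtain ⟨k, hk⟩ := (Module.End.mem_maxGenEigenspace _ _ _).1 hv
  have hk' : (M - μ • 1) ^ k *ᵥ v = 0 := by
    rw [← hk, ← Matrix.toLinAlgEquiv'_apply, map_pow, map_sub, map_smul, map_one]
  by_cases hμ : μ ∈ spectrum ℂ M
  · exact mem_decaySubmodule_of_pow_mulVec_eq_zero (hM μ hμ) hk'
  · have hunit : IsUnit (M - μ • 1) := by
      rw [spectrum.notMem_iff, Algebra.algebraMap_eq_smul_one] at hμ
      simpa only [neg_sub] using hμ.neg
    have hv₀ : v = 0 := Matrix.mulVec_injective_of_isUnit (hunit.pow k)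
      (hk'.trans (Matrix.mulVec_zero _).symm)
    exact hv₀ ▸ Submodule.zero_mem _

/-- The state-transition matrix of `x' = A x`. -/
noncomputable def transition (A : Matrix ι ι ℝ) (t : ℝ) : Matrix ι ι ℝ :=
  NormedSpace.exp (t • A)

theorem transition_zero (A : Matrix ι ι ℝ) : transition A 0 = 1 := by
  rw [transition, zero_smul, NormedSpace.exp_zero]

theorem transition_mul_comm (A : Matrix ι ι ℝ) (t : ℝ) :
    transition A t * A = A * transition A t :=
  ((Commute.refl A).smul_left t).exp_left

theorem isUnit_transition (A : Matrix ι ι ℝ) (t : ℝ) : IsUnit (transition A t) :=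
  Matrix.isUnit_exp _

theorem hasDerivAt_transition_mulVec (A : Matrix ι ι ℝ) (v : ι → ℝ) (t : ℝ) :
    HasDerivAt (fun s => transition A s *ᵥ v) (A *ᵥ (transition A t *ᵥ v)) t := by
  let applyTo : Matrix ι ι ℝ →L[ℝ] ι → ℝ :=
    LinearMap.toContinuousLinearMap ((Matrix.mulVecBilin ℝ ℝ).flip v)
  rw [Matrix.mulVec_mulVec, ← transition_mul_comm]
  exact applyTo.hasFDerivAt.comp_hasDerivAt t (hasDerivAt_exp_smul_const A t)

theorem hasDerivAt_transition_apply (A : Matrix ι ι ℝ) (t : ℝ) (i j : ι) :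
    HasDerivAt (fun s => transition A s i j) ((transition A t * A) i j) t :=
  (LinearMap.toContinuousLinearMap (Matrix.entryLinearMap ℝ ℝ i j)).hasFDerivAt.comp_hasDerivAt t
    (hasDerivAt_exp_smul_const A t)

theorem continuous_transition_mulVec (A : Matrix ι ι ℝ) (v : ι → ℝ) :
    Continuous fun t => transition A t *ᵥ v :=
  continuous_iff_continuousAt.2 fun t => (hasDerivAt_transition_mulVec A v t).continuousAt

/-- The impulse response from the input `f` to the `i`-th coordinate of `x' = A x + f b`. -/
noncomputable def hoKernel (A : Matrix ι ι ℝ) (b : ι → ℝ) (i : ι) (t : ℝ) : ℝ :=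
  (transition A t *ᵥ b) i

theorem continuous_hoKernel (A : Matrix ι ι ℝ) (b : ι → ℝ) (i : ι) : Continuous (hoKernel A b i) :=
  continuous_pi_iff.1 (continuous_transition_mulVec A b) i

theorem map_transition (A : Matrix ι ι ℝ) (t : ℝ) :
    (transition A t).map (algebraMap ℝ ℂ) = NormedSpace.exp (t • A.map (algebraMap ℝ ℂ)) := by
  let : NormedAlgebra ℚ (Matrix ι ι ℝ) := NormedAlgebra.restrictScalars ℚ ℝ _
  let : NormedAlgebra ℚ (Matrix ι ι ℂ) := NormedAlgebra.restrictScalars ℚ ℝ _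
  have hcont : Continuous ((algebraMap ℝ ℂ).mapMatrix : Matrix ι ι ℝ →+* Matrix ι ι ℂ) :=
    continuous_id.matrix_map Complex.continuous_ofReal
  have hsmul : (t • A).map (algebraMap ℝ ℂ) = t • A.map (algebraMap ℝ ℂ) :=
    Matrix.map_smul _ _ (fun a => by simp) A
  exact hsmul ▸ NormedSpace.map_exp ((algebraMap ℝ ℂ).mapMatrix : Matrix ι ι ℝ →+* _) hcont (t • A)

end MatrixExponential

section HurwitzDecay

variable {n : ℕ} {A : Matrix (Fin n) (Fin n) ℝ}

theorem exists_transition_isBigO_exp (hA : IsHurwitz A) (v : Fin n → ℝ) :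
    ∃ α > 0, (fun t => transition A t *ᵥ v) =O[atTop] fun t => Real.exp (-α * t) := by
  have hmem : (fun i => algebraMap ℝ ℂ (v i)) ∈ decaySubmodule (A.map (algebraMap ℝ ℂ)) :=
    decaySubmodule_eq_top hA ▸ Submodule.mem_top
  obtain ⟨α, hα, hdecay⟩ := hmem
  refine ⟨α, hα, Asymptotics.isBigO_pi.2 fun i => ?_⟩
  refine Asymptotics.IsBigO.trans (.of_norm_le fun t => ?_)
    (Asymptotics.isBigO_pi.1 hdecay i).norm_left
  have hcast := RingHom.map_mulVec (algebraMap ℝ ℂ) (transition A t) v i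
  rw [← map_transition]
  exact ((Complex.norm_real _).symm.trans (congrArg norm hcast)).le

theorem tendsto_transition_mulVec (hA : IsHurwitz A) (v : Fin n → ℝ) :
    Tendsto (fun t => transition A t *ᵥ v) atTop (𝓝 0) := by
  obtain ⟨α, hα, hdecay⟩ := exists_transition_isBigO_exp hA v
  refine hdecay.trans_tendsto (Real.tendsto_exp_atBot.comp ?_)
  exact tendsto_id.const_mul_atTop_of_neg (neg_lt_zero.2 hα)

theorem integrableOn_hoKernel (hA : IsHurwitz A) (b : Fin n → ℝ) (i : Fin n) :
    IntegrableOn (hoKernel A b i) (Ioi 0) := by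
  obtain ⟨α, hα, hdecay⟩ := exists_transition_isBigO_exp hA b
  exact integrable_of_isBigO_exp_neg hα (continuous_hoKernel A b i).continuousOn
    (Asymptotics.isBigO_pi.1 hdecay i)

end HurwitzDecay

section QuadraticForms

variable {ι : Type*} [Fintype ι]

theorem hasDerivWithinAt_dotProduct {f g : ℝ → ι → ℝ} {f' g' : ι → ℝ} {s : Set ℝ} {t : ℝ}
    (hf : HasDerivWithinAt f f' s t) (hg : HasDerivWithinAt g g' s t) :
    HasDerivWithinAt (fun u => f u ⬝ᵥ g u) (f' ⬝ᵥ g t + f t ⬝ᵥ g') s t := by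
  simp only [dotProduct, ← Finset.sum_add_distrib]
  exact HasDerivWithinAt.fun_sum fun i _ =>
    (hasDerivWithinAt_pi.1 hf i).mul (hasDerivWithinAt_pi.1 hg i)

theorem hasDerivWithinAt_mulVec {κ : Type*} [Finite κ] (M : Matrix κ ι ℝ) {g : ℝ → ι → ℝ}
    {g' : ι → ℝ} {s : Set ℝ} {t : ℝ} (hg : HasDerivWithinAt g g' s t) :
    HasDerivWithinAt (fun u => M *ᵥ g u) (M *ᵥ g') s t := by
  have := Fintype.ofFinite κ
  exact (LinearMap.toContinuousLinearMap M.mulVecLin).hasFDerivAt.comp_hasDerivWithinAt t hg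

theorem dotProduct_mulVec_comm_of_isSymm {P : Matrix ι ι ℝ} (hP : P.IsSymm) (v w : ι → ℝ) :
    v ⬝ᵥ (P *ᵥ w) = w ⬝ᵥ (P *ᵥ v) := by
  rw [Matrix.dotProduct_mulVec, ← Matrix.mulVec_transpose, hP, dotProduct_comm]

theorem mulVec_dotProduct_mulVec_add (A N : Matrix ι ι ℝ) (v w : ι → ℝ) :
    (A *ᵥ v) ⬝ᵥ (N *ᵥ w) + v ⬝ᵥ (N *ᵥ (A *ᵥ w)) = v ⬝ᵥ ((Aᵀ * N + N * A) *ᵥ w) := by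
  rw [Matrix.add_mulVec, dotProduct_add, ← Matrix.mulVec_mulVec, ← Matrix.mulVec_mulVec,
    Matrix.dotProduct_mulVec v Aᵀ, Matrix.vecMul_transpose]

theorem exists_pos_mul_norm_sq_le_of_posDef {P : Matrix ι ι ℝ} (hP : P.PosDef) :
    ∃ κ > 0, ∀ v : ι → ℝ, κ * ‖v‖ ^ 2 ≤ v ⬝ᵥ (P *ᵥ v) := by
  have hcont : Continuous fun v : ι → ℝ => v ⬝ᵥ (P *ᵥ v) := by fun_prop
  have hsphere : ∃ κ > 0, ∀ v ∈ Metric.sphere (0 : ι → ℝ) 1, κ ≤ v ⬝ᵥ (P *ᵥ v) := by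
    rcases (Metric.sphere (0 : ι → ℝ) 1).eq_empty_or_nonempty with hempty | hne
    · exact ⟨1, one_pos, by simp only [hempty, mem_empty_iff_false, false_imp_iff, implies_true]⟩
    · obtain ⟨w, hw, hmin⟩ := (isCompact_sphere 0 1).exists_isMinOn hne hcont.continuousOn
      have hw₀ : w ≠ 0 := ne_zero_of_mem_sphere one_ne_zero ⟨w, hw⟩
      exact ⟨_, by simpa only [star_trivial] using hP.dotProduct_mulVec_pos hw₀,
        fun v hv => hmin hv⟩
  obtain ⟨κ, hκ, hmin⟩ := hsphere
  refine ⟨κ, hκ, fun v => ?_⟩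
  rcases eq_or_ne v 0 with rfl | hv
  · simp only [norm_zero, ne_eq, OfNat.ofNat_ne_zero, not_false_eq_true, zero_pow, mul_zero,
      zero_dotProduct, le_refl]
  have hscaled := hmin (‖v‖⁻¹ • v) (by simp [norm_smul, hv])
  rw [Matrix.mulVec_smul, smul_dotProduct, dotProduct_smul, smul_eq_mul, smul_eq_mul,
    ← mul_assoc, ← mul_inv, inv_mul_eq_div, le_div_iff₀ (by positivity), ← pow_two] at hscaled
  exact hscaled

end QuadraticForms

section LyapunovEquation

variable {n : ℕ} {A N P Q : Matrix (Fin n) (Fin n) ℝ}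

theorem hasDerivAt_transition_bilinear (A N : Matrix (Fin n) (Fin n) ℝ) (v w : Fin n → ℝ)
    (t : ℝ) :
    HasDerivAt (fun s => (transition A s *ᵥ v) ⬝ᵥ (N *ᵥ (transition A s *ᵥ w)))
      ((transition A t *ᵥ v) ⬝ᵥ ((Aᵀ * N + N * A) *ᵥ (transition A t *ᵥ w))) t := by
  rw [← mulVec_dotProduct_mulVec_add, ← hasDerivWithinAt_univ]
  exact hasDerivWithinAt_dotProduct (hasDerivAt_transition_mulVec A v t).hasDerivWithinAt
    (hasDerivWithinAt_mulVec N (hasDerivAt_transition_mulVec A w t).hasDerivWithinAt)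

theorem tendsto_transition_bilinear (hA : IsHurwitz A) (N : Matrix (Fin n) (Fin n) ℝ)
    (v w : Fin n → ℝ) :
    Tendsto (fun s => (transition A s *ᵥ v) ⬝ᵥ (N *ᵥ (transition A s *ᵥ w))) atTop (𝓝 0) := by
  have hcont : Continuous fun p : (Fin n → ℝ) × (Fin n → ℝ) => p.1 ⬝ᵥ (N *ᵥ p.2) := by fun_prop
  simpa only [Function.comp_def, Matrix.mulVec_zero, dotProduct_zero] using
    (hcont.tendsto (0, 0)).comp
      ((tendsto_transition_mulVec hA v).prodMk_nhds (tendsto_transition_mulVec hA w))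

theorem eq_zero_of_lyapunov_homogeneous (hA : IsHurwitz A) (hN : Aᵀ * N + N * A = 0) : N = 0 := by
  have hform (v w : Fin n → ℝ) : v ⬝ᵥ (N *ᵥ w) = 0 := by
    have hderiv (t : ℝ) := hasDerivAt_transition_bilinear A N v w t
    simp only [hN, Matrix.zero_mulVec, dotProduct_zero] at hderiv
    have hconst := is_const_of_deriv_eq_zero (fun t => (hderiv t).differentiableAt)
      (fun t => (hderiv t).deriv)
    have hlim := tendsto_nhds_unique (tendsto_transition_bilinear hA N v w)
      (tendsto_const_nhds.congr (hconst 0))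
    simpa only [transition_zero, Matrix.one_mulVec] using hlim.symm
  ext i j
  simpa only [Matrix.mulVec_single_one, single_one_dotProduct, Matrix.col_apply] using!
    hform (Pi.single i 1) (Pi.single j 1)

theorem isSymm_of_lyapunov (hA : IsHurwitz A) (hQ : Q.IsSymm) (hP : Aᵀ * P + P * A = -Q) :
    P.IsSymm := by
  have htranspose : Aᵀ * Pᵀ + Pᵀ * A = -Q := by
    rw [← hQ.eq, ← Matrix.transpose_neg, ← hP, Matrix.transpose_add, Matrix.transpose_mul,
      Matrix.transpose_mul, Matrix.transpose_transpose, add_comm]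
  refine sub_eq_zero.1 (eq_zero_of_lyapunov_homogeneous hA (N := Pᵀ - P) ?_)
  rw [Matrix.mul_sub, Matrix.sub_mul, sub_add_sub_comm, htranspose, hP, sub_self]

theorem posDef_of_lyapunov (hA : IsHurwitz A) (hQ : Q.PosDef) (hP : Aᵀ * P + P * A = -Q) :
    P.PosDef := by
  have hQsymm : Q.IsSymm := (Matrix.conjTranspose_eq_transpose_of_trivial Q).symm.trans hQ.1
  refine .of_dotProduct_mulVec_pos ((Matrix.conjTranspose_eq_transpose_of_trivial P).trans
    (isSymm_of_lyapunov hA hQsymm hP)) fun v hv => ?_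
  have hne (t : ℝ) : transition A t *ᵥ v ≠ 0 := fun hzero =>
    hv (Matrix.mulVec_injective_of_isUnit (isUnit_transition A t)
      (hzero.trans (Matrix.mulVec_zero _).symm))
  have hanti : StrictAnti fun s => (transition A s *ᵥ v) ⬝ᵥ (P *ᵥ (transition A s *ᵥ v)) :=
    strictAnti_of_deriv_neg fun t => by
      rw [(hasDerivAt_transition_bilinear A P v v t).deriv, hP, Matrix.neg_mulVec, dotProduct_neg,
        neg_lt_zero]
      simpa only [star_trivial] using hQ.dotProduct_mulVec_pos (hne t)
  have hlt := hanti one_pos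
  simp only [transition_zero, Matrix.one_mulVec] at hlt
  rw [star_trivial]
  exact (hanti.antitone.le_of_tendsto (tendsto_transition_bilinear hA P v v) 1).trans_lt hlt

end LyapunovEquation

section VariationOfConstants

variable {ι : Type*} [Fintype ι] [DecidableEq ι]

theorem variation_of_constants {A : Matrix ι ι ℝ} {b : ι → ℝ} {x : ℝ → ι → ℝ} {f : ℝ → ℝ}
    (hx : ∀ t, 0 ≤ t → HasDerivWithinAt x (A *ᵥ x t + f t • b) (Ici 0) t)
    (hf : ContinuousOn f (Ici 0)) {t : ℝ} (ht : 0 ≤ t) (i : ι) :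
    x t i = (transition A t *ᵥ x 0) i + causalConv (hoKernel A b i) f t := by
  have hrow (τ : ℝ) : HasDerivAt (fun τ => transition A (t - τ) i)
      (-(transition A (t - τ) * A) i) τ := by
    refine hasDerivAt_pi.2 fun j => ?_
    simpa only [Function.comp_def, mul_neg_one] using!
      (hasDerivAt_transition_apply A (t - τ) i j).comp τ ((hasDerivAt_id τ).const_sub t)
  have hderiv (τ : ℝ) (hτ : 0 ≤ τ) : HasDerivWithinAt (fun τ => (transition A (t - τ) *ᵥ x τ) i)
      (hoKernel A b i (t - τ) * f τ) (Ici 0) τ := by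
    refine (hasDerivWithinAt_dotProduct (hrow τ).hasDerivWithinAt (hx τ hτ)).congr_deriv ?_
    have hassoc : (transition A (t - τ) * A) i ⬝ᵥ x τ = transition A (t - τ) i ⬝ᵥ (A *ᵥ x τ) :=
      (congrFun (Matrix.mulVec_mulVec (x τ) (transition A (t - τ)) A) i).symm
    rw [neg_dotProduct, hassoc, dotProduct_add, dotProduct_smul, smul_eq_mul, mul_comm,
      neg_add_cancel_left]
    rfl
  have hint : IntervalIntegrable (fun τ => hoKernel A b i (t - τ) * f τ) volume 0 t :=
    (hf.mono (uIcc_of_le ht ▸ Icc_subset_Ici_self)).intervalIntegrable.continuousOn_mul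
      ((continuous_hoKernel A b i).comp (continuous_sub_left t)).continuousOn
  have hftc := intervalIntegral.integral_eq_sub_of_hasDerivAt_of_le ht
    (fun τ hτ => ((hderiv τ hτ.1).continuousWithinAt).mono Icc_subset_Ici_self)
    (fun τ hτ => (hderiv τ hτ.1.le).hasDerivAt (Ici_mem_nhds hτ.1)) hint
  rw [sub_self, sub_zero, transition_zero, Matrix.one_mulVec] at hftc
  rw [causalConv, hftc, add_sub_cancel]

end VariationOfConstants

section FourierUniqueness

variable {E : Type*} [NormedAddCommGroup E] [InnerProductSpace ℝ E] [MeasurableSpace E]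
  {μ : Measure E} {d : E → ℝ}

theorem integrable_smul_exp_inner [OpensMeasurableSpace E] (hd : Integrable d μ) (ω : E) :
    Integrable (fun x => d x • Complex.exp (inner ℝ x ω * Complex.I)) μ := by
  refine hd.smul_bdd 1 ?_ (.of_forall fun x => (Complex.norm_exp_ofReal_mul_I _).le)
  exact (by fun_prop : Continuous fun x : E =>
    Complex.exp (inner ℝ x ω * Complex.I)).aestronglyMeasurable

theorem charFun_withDensity_ofReal (hd : AEMeasurable d μ) (ω : E) :
    charFun (μ.withDensity fun x => ENNReal.ofReal (d x)) ω =
      ∫ x, max (d x) 0 • Complex.exp (inner ℝ x ω * Complex.I) ∂μ := by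
  rw [charFun_apply, integral_withDensity_eq_integral_toReal_smul₀ hd.ennreal_ofReal
    (.of_forall fun _ => ENNReal.ofReal_lt_top)]
  simp only [ENNReal.toReal_ofReal']

theorem ae_eq_zero_of_integral_smul_exp_inner_eq_zero [BorelSpace E] [SecondCountableTopology E]
    [CompleteSpace E] (hd : Integrable d μ)
    (hzero : ∀ ω : E, ∫ x, d x • Complex.exp (inner ℝ x ω * Complex.I) ∂μ = 0) : d =ᵐ[μ] 0 := by
  have := isFiniteMeasure_withDensity_ofReal hd.2
  have := isFiniteMeasure_withDensity_ofReal hd.neg.2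
  -- The measures with densities `d⁺` and `d⁻` are finite and have the same characteristic function.
  have hmeasures : (μ.withDensity fun x => ENNReal.ofReal (d x)) =
      μ.withDensity fun x => ENNReal.ofReal (-d x) := by
    refine Measure.ext_of_charFun (funext fun ω => ?_)
    rw [charFun_withDensity_ofReal hd.aemeasurable,
      charFun_withDensity_ofReal (d := fun x => -d x) hd.neg.aemeasurable, ← sub_eq_zero,
      ← integral_sub (integrable_smul_exp_inner hd.pos_part ω)
        (integrable_smul_exp_inner hd.neg_part ω), ← hzero ω]
    simp only [← sub_smul, max_zero_sub_max_neg_zero_eq_self]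
  have hparts := (withDensity_eq_iff hd.aemeasurable.ennreal_ofReal
    hd.neg.aemeasurable.ennreal_ofReal hd.lintegral_lt_top.ne).1 hmeasures
  filter_upwards [hparts] with x hx
  have hmax := congrArg ENNReal.toReal hx
  rw [ENNReal.toReal_ofReal', ENNReal.toReal_ofReal', ← sub_eq_zero] at hmax
  exact (max_zero_sub_max_neg_zero_eq_self (d x)).symm.trans hmax

end FourierUniqueness

section LaplaceTransform

variable {f h φ φ' : ℝ → ℝ} {s : ℂ}

/-- The Laplace transform of a signal on `[0, ∞)`. -/
noncomputable def laplace (h : ℝ → ℝ) (s : ℂ) : ℂ :=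
  ∫ t in Ioi (0 : ℝ), Complex.exp (-s * t) * (h t : ℂ)

theorem integrableOn_exp_neg_mul (hh : IntegrableOn h (Ioi 0)) (hs : 0 ≤ s.re) :
    IntegrableOn (fun t : ℝ => Complex.exp (-s * t) * (h t : ℂ)) (Ioi 0) := by
  refine Integrable.bdd_mul (c := 1) hh.ofReal ?_ ?_
  · exact (by fun_prop : Continuous fun t : ℝ => Complex.exp (-s * t)).aestronglyMeasurable
  · filter_upwards [ae_restrict_mem measurableSet_Ioi] with t ht
    rw [Complex.norm_exp, Real.exp_le_one_iff, Complex.re_mul_ofReal, Complex.neg_re]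
    exact mul_nonpos_of_nonpos_of_nonneg (neg_nonpos.2 hs) (mem_Ioi.1 ht).le

theorem laplace_sub (hf : IntegrableOn f (Ioi 0)) (hh : IntegrableOn h (Ioi 0)) (hs : 0 ≤ s.re) :
    laplace (fun t => f t - h t) s = laplace f s - laplace h s := by
  simp only [laplace, Complex.ofReal_sub, mul_sub]
  exact integral_sub (integrableOn_exp_neg_mul hf hs) (integrableOn_exp_neg_mul hh hs)

theorem laplace_mulVec {ι κ : Type*} [Fintype ι] (M : Matrix κ ι ℝ) {φ : ℝ → ι → ℝ}
    (hφ : ∀ j, IntegrableOn (fun t => φ t j) (Ioi 0)) (hs : 0 ≤ s.re) (i : κ) :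
    laplace (fun t => (M *ᵥ φ t) i) s =
      (M.map (algebraMap ℝ ℂ) *ᵥ fun j => laplace (fun t => φ t j) s) i := by
  simp only [laplace, Matrix.mulVec, dotProduct, Matrix.map_apply, Complex.coe_algebraMap,
    ← integral_const_mul]
  rw [← integral_finsetSum _ fun j _ => (integrableOn_exp_neg_mul (hφ j) hs).const_mul _]
  refine integral_congr_ae (.of_forall fun t => ?_)
  simp only [Complex.ofReal_sum, Complex.ofReal_mul, Finset.mul_sum]
  exact Finset.sum_congr rfl fun j _ => mul_left_comm _ _ _

theorem laplace_deriv (hφ : ∀ t, HasDerivAt φ (φ' t) t) (hint : IntegrableOn φ (Ioi 0))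
    (hint' : IntegrableOn φ' (Ioi 0)) (hs : 0 ≤ s.re) :
    laplace φ' s = s * laplace φ s - φ 0 := by
  have hderiv (t : ℝ) : HasDerivAt (fun t : ℝ => Complex.exp (-s * t) * (φ t : ℂ))
      (Complex.exp (-s * t) * (φ' t : ℂ) - s * (Complex.exp (-s * t) * (φ t : ℂ))) t := by
    have hexp : HasDerivAt (fun t : ℝ => Complex.exp (-s * t)) (Complex.exp (-s * t) * -s) t := by
      simpa only [mul_one, id_eq] using ((hasDerivAt_id (t : ℂ)).const_mul (-s)).cexp.comp_ofReal
    refine (hexp.mul (hφ t).ofReal_comp).congr_deriv ?_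
    ring
  have hintφ := integrableOn_exp_neg_mul hint hs
  have hintφ' := integrableOn_exp_neg_mul hint' hs
  have hint_deriv := hintφ'.sub (hintφ.const_mul s)
  have hlim := tendsto_zero_of_hasDerivAt_of_integrableOn_Ioi (fun t _ => hderiv t) hint_deriv hintφ
  have hftc := integral_Ioi_of_hasDerivAt_of_tendsto' (fun t _ => hderiv t) hint_deriv hlim
  rw [integral_sub hintφ' (hintφ.const_mul s), integral_const_mul, Complex.ofReal_zero, mul_zero,
    Complex.exp_zero, one_mul, zero_sub] at hftc
  rw [laplace, laplace, sub_eq_iff_eq_add.1 hftc, neg_add_eq_sub]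

theorem laplace_causalConv (hf : IntegrableOn f (Ioi 0)) (hh : IntegrableOn h (Ioi 0))
    (hs : 0 ≤ s.re) : laplace (causalConv f h) s = laplace f s * laplace h s := by
  rw [causalConv_comm]
  have hconv := integral_posConvolution (integrableOn_exp_neg_mul hf hs)
    (integrableOn_exp_neg_mul hh hs) (ContinuousLinearMap.mul ℝ ℂ)
  simp only [ContinuousLinearMap.mul_apply'] at hconv
  rw [laplace, laplace, laplace, ← hconv]
  refine setIntegral_congr_fun measurableSet_Ioi fun t _ => ?_
  simp only [causalConv, ← intervalIntegral.integral_ofReal, ← intervalIntegral.integral_const_mul]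
  refine intervalIntegral.integral_congr fun τ _ => ?_
  have hexp : Complex.exp (-s * t) = Complex.exp (-s * τ) * Complex.exp (-s * (t - τ : ℝ)) := by
    rw [← Complex.exp_add, Complex.ofReal_sub]
    ring_nf
  simp only [hexp, Complex.ofReal_mul]
  ring

theorem ae_eq_zero_of_laplace_eq_zero (hf : IntegrableOn f (Ioi 0))
    (hzero : ∀ s : ℂ, 0 ≤ s.re → laplace f s = 0) : f =ᵐ[volume.restrict (Ioi 0)] 0 := by
  refine ae_eq_zero_of_integral_smul_exp_inner_eq_zero hf fun ω => ?_
  have hfourier := hzero (-(ω * Complex.I)) (by simp)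
  rw [laplace] at hfourier
  rw [← hfourier]
  refine integral_congr_ae (.of_forall fun t => ?_)
  simp only [Complex.real_smul, neg_neg, RCLike.inner_apply, conj_trivial, Complex.ofReal_mul]
  ring_nf

end LaplaceTransform

section ImpulseResponses

variable {f h : ℝ → ℝ} {F H : ℂ → ℂ}

theorem IsImpulseResponse.sub (hf : IsImpulseResponse f F) (hh : IsImpulseResponse h H) :
    IsImpulseResponse (fun t => f t - h t) (fun s => F s - H s) :=
  ⟨hf.1.sub hh.1, fun s hs =>
    (laplace_sub hf.1 hh.1 hs).trans (congrArg₂ _ (hf.2 s hs) (hh.2 s hs))⟩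

theorem IsImpulseResponse.causalConv (hf : IsImpulseResponse f F) (hh : IsImpulseResponse h H) :
    IsImpulseResponse (causalConv f h) (fun s => F s * H s) :=
  ⟨integrableOn_causalConv hf.1 hh.1, fun s hs =>
    (laplace_causalConv hf.1 hh.1 hs).trans (congrArg₂ _ (hf.2 s hs) (hh.2 s hs))⟩

theorem IsImpulseResponse.ae_eq (hf : IsImpulseResponse f H) (hh : IsImpulseResponse h H) :
    f =ᵐ[volume.restrict (Ioi 0)] h := by
  have hdiff := hf.sub hh
  filter_upwards [ae_eq_zero_of_laplace_eq_zero hdiff.1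
    fun s hs => (hdiff.2 s hs).trans (sub_self _)] with t ht using sub_eq_zero.1 ht

theorem IsImpulseResponse.ofReal_integral (hh : IsImpulseResponse h H) :
    ((∫ t in Ioi (0 : ℝ), h t : ℝ) : ℂ) = H 0 := by
  rw [← hh.2 0 le_rfl, ← integral_complex_ofReal]
  simp only [neg_zero, zero_mul, Complex.exp_zero, one_mul]

theorem IsImpulseResponse.ofReal_l1Norm_le_l1Gain (hh : IsImpulseResponse h H) :
    ENNReal.ofReal (l1Norm h) ≤ l1Gain H := by
  refine le_iInf₂ fun g hg => ?_
  rw [l1Norm, ofReal_integral_eq_lintegral_ofReal hh.1.abs (.of_forall fun _ => abs_nonneg _)]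
  refine (lintegral_congr_ae ?_).le
  filter_upwards [hh.ae_eq hg] with t ht
  rw [ht]

variable {n : ℕ} {A : Matrix (Fin n) (Fin n) ℝ}

theorem isUnit_resolvent (hA : IsHurwitz A) {s : ℂ} (hs : 0 ≤ s.re) :
    IsUnit (s • (1 : Matrix (Fin n) (Fin n) ℂ) - A.map (algebraMap ℝ ℂ)) := by
  rw [← Algebra.algebraMap_eq_smul_one, ← spectrum.notMem_iff]
  exact fun hmem => (hA s hmem).not_ge hs

theorem isImpulseResponse_hoKernel (hA : IsHurwitz A) (b : Fin n → ℝ) (i : Fin n) :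
    IsImpulseResponse (hoKernel A b i) (fun s => Ho ℂ A b s i) := by
  refine ⟨integrableOn_hoKernel hA b i, fun s hs => ?_⟩
  have hresolvent : (s • (1 : Matrix (Fin n) (Fin n) ℂ) - A.map (algebraMap ℝ ℂ)) *ᵥ
      (fun j => laplace (hoKernel A b j) s) = fun j => algebraMap ℝ ℂ (b j) := by
    ext j
    have hint : IntegrableOn (fun t => (A *ᵥ (transition A t *ᵥ b)) j) (Ioi 0) := by
      simp only [Matrix.mulVec_eq_sum, Finset.sum_apply]
      exact integrable_finsetSum _ fun k _ => (integrableOn_hoKernel hA b k).const_mul _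
    have hderiv := laplace_deriv
      (fun t => hasDerivAt_pi.1 (hasDerivAt_transition_mulVec A b t) j)
      (integrableOn_hoKernel hA b j) hint hs
    rw [laplace_mulVec A (φ := fun t => transition A t *ᵥ b) (integrableOn_hoKernel hA b) hs,
      transition_zero, Matrix.one_mulVec] at hderiv
    rw [Matrix.sub_mulVec, Matrix.smul_mulVec, Matrix.one_mulVec, Pi.sub_apply, Pi.smul_apply,
      smul_eq_mul]
    exact (congrArg _ hderiv).trans (sub_sub_cancel _ _)
  change laplace (hoKernel A b i) s = Ho ℂ A b s i
  rw [Ho, ← hresolvent, Matrix.mulVec_mulVec, Matrix.nonsing_inv_mul _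
    ((Matrix.isUnit_iff_isUnit_det _).1 (isUnit_resolvent hA hs)), Matrix.one_mulVec]

theorem nonsing_inv_map {F K ι : Type*} [Field F] [Field K] [Fintype ι] [DecidableEq ι]
    (f : F →+* K) (M : Matrix ι ι F) : (M.map f)⁻¹ = M⁻¹.map f := by
  have hdet := f.map_det M
  have hadj := f.map_adjugate M
  simp only [RingHom.mapMatrix_apply] at hdet hadj
  ext j k
  simp only [Matrix.inv_def, ← hdet, ← hadj, Ring.inverse_eq_inv', Matrix.smul_apply,
    Matrix.map_apply, smul_eq_mul, map_mul, map_inv₀]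

theorem Ho_ofReal (A : Matrix (Fin n) (Fin n) ℝ) (b : Fin n → ℝ) (s : ℝ) (i : Fin n) :
    Ho ℂ A b s i = (Ho ℝ A b s i : ℂ) := by
  have hmap : (s : ℂ) • (1 : Matrix (Fin n) (Fin n) ℂ) - A.map (algebraMap ℝ ℂ) =
      (s • (1 : Matrix (Fin n) (Fin n) ℝ) - A.map (algebraMap ℝ ℝ)).map Complex.ofRealHom := by
    ext j k
    simp [Matrix.one_apply, apply_ite]
  rw [Ho, Ho, hmap, nonsing_inv_map]
  exact (RingHom.map_mulVec Complex.ofRealHom _ b i).symm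

theorem integral_hoKernel (hA : IsHurwitz A) (b : Fin n → ℝ) (i : Fin n) :
    ∫ t in Ioi (0 : ℝ), hoKernel A b i t = Ho ℝ A b 0 i := by
  have hintegral := (isImpulseResponse_hoKernel hA b i).ofReal_integral
  rw [← Complex.ofReal_zero, Ho_ofReal] at hintegral
  exact Complex.ofReal_injective hintegral

/-- The impulse response of the `i`-th component of `Ḡ = H_o (C - 1)`, for a filter `C` with impulse
response `h`. -/
noncomputable def gbarKernel (A : Matrix (Fin n) (Fin n) ℝ) (b : Fin n → ℝ) (h : ℝ → ℝ)
    (i : Fin n) (t : ℝ) : ℝ :=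
  causalConv (hoKernel A b i) h t - hoKernel A b i t

theorem isImpulseResponse_gbarKernel {C : ℂ → ℂ} (hA : IsHurwitz A) (b : Fin n → ℝ)
    (hh : IsImpulseResponse h C) (i : Fin n) :
    IsImpulseResponse (gbarKernel A b h i) (fun s => Gbar A b C s i) := by
  have hho := isImpulseResponse_hoKernel hA b i
  simpa only [Gbar, mul_sub_one] using! (hho.causalConv hh).sub hho

theorem integral_gbarKernel {C : ℂ → ℂ} (hA : IsHurwitz A) (b : Fin n → ℝ)
    (hh : IsImpulseResponse h C) (hC0 : C 0 = 1) (i : Fin n) :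
    ∫ t in Ioi (0 : ℝ), gbarKernel A b h i t = 0 := by
  have hintegral := (isImpulseResponse_gbarKernel hA b hh i).ofReal_integral
  rwa [Gbar, hC0, sub_self, mul_zero, Complex.ofReal_eq_zero] at hintegral

theorem l1Norm_mul_lt_one_of_l1GainVec_mul_lt_one {G : ℂ → Fin n → ℂ} {g : Fin n → ℝ → ℝ} {ρ : ℝ}
    (hg : ∀ i, IsImpulseResponse (g i) (fun s => G s i))
    (hgain : l1GainVec G * ENNReal.ofReal ρ < 1) (i : Fin n) : l1Norm (g i) * ρ < 1 := by
  have hle : ENNReal.ofReal (l1Norm (g i)) ≤ l1GainVec G :=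
    (hg i).ofReal_l1Norm_le_l1Gain.trans (le_iSup (fun i => l1Gain fun s => G s i) i)
  rw [← ENNReal.ofReal_lt_one, ENNReal.ofReal_mul (l1Norm_nonneg _)]
  exact (mul_le_mul_left hle _).trans_lt hgain

end ImpulseResponses

section TangentConeProjection

theorem exists_forall_sub_dotProduct_sub_le {ι : Type*} [Fintype ι] {S : Set (ι → ℝ)}
    (hS : IsClosed S) (hne : S.Nonempty) (y : ι → ℝ) :
    ∃ v ∈ S, ∀ w ∈ S, (y - v) ⬝ᵥ (y - v) ≤ (y - w) ⬝ᵥ (y - w) := by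
  obtain ⟨a, ha⟩ := hne
  obtain ⟨v, hv, hdist⟩ :=
    (hS.preimage (PiLp.continuous_ofLp 2 fun _ : ι => ℝ)).exists_infDist_eq_dist
      ⟨WithLp.toLp 2 a, ha⟩ (WithLp.toLp 2 y)
  refine ⟨v.ofLp, hv, fun w hw => ?_⟩
  have hle : dist (WithLp.toLp 2 y) v ≤ dist (WithLp.toLp 2 y) (WithLp.toLp 2 w) :=
    hdist ▸ Metric.infDist_le_dist_of_mem (s := WithLp.ofLp ⁻¹' S) hw
  rw [EuclideanSpace.dist_eq, EuclideanSpace.dist_eq, Real.sqrt_le_sqrt_iff (by positivity)] at hle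
  simpa only [Real.dist_eq, sq_abs, dotProduct, Pi.sub_apply, ← sq] using! hle

theorem sub_dotProduct_nonpos_of_forall_sub_dotProduct_sub_le {ι : Type*} [Fintype ι]
    {y v w : ι → ℝ}
    (hmin : ∀ s : ℝ, 0 < s → (y - v) ⬝ᵥ (y - v) ≤ (y - (v + s • w)) ⬝ᵥ (y - (v + s • w))) :
    (y - v) ⬝ᵥ w ≤ 0 := by
  have hslope (s : ℝ) (hs : 0 < s) : 2 * ((y - v) ⬝ᵥ w) ≤ s * (w ⬝ᵥ w) := by
    have hmin_s := hmin s hs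
    rw [← sub_sub] at hmin_s
    generalize y - v = z at hmin_s ⊢
    simp only [sub_dotProduct, dotProduct_sub, smul_dotProduct, dotProduct_smul, smul_eq_mul,
      dotProduct_comm w z] at hmin_s
    refine le_of_mul_le_mul_left ?_ hs
    linarith
  have hlim : Tendsto (fun s : ℝ => s * (w ⬝ᵥ w)) (𝓝[>] 0) (𝓝 0) :=
    ((continuous_mul_const (w ⬝ᵥ w)).tendsto' 0 0 (zero_mul _)).mono_left nhdsWithin_le_nhds
  have hle := ge_of_tendsto hlim (eventually_mem_nhdsWithin.mono hslope)
  linarith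

variable {n : ℕ} {Ω : Set (Fin n → ℝ)} {ϑ θ : Fin n → ℝ}

theorem tangentCone_eq_closure_hull (hΩ : Convex ℝ Ω) (ϑ : Fin n → ℝ) :
    tangentCone Ω ϑ = (ConvexCone.hull ℝ ((ϑ + ·) ⁻¹' Ω)).closure := by
  rw [ConvexCone.coe_closure, tangentCone]
  congr 1
  ext v
  rw [SetLike.mem_coe, ConvexCone.mem_hull_of_convex (hΩ.translate_preimage_right ϑ)]
  constructor
  · rintro ⟨ε, hε, hv⟩
    exact ⟨ε⁻¹, inv_pos.2 hε, (mem_inv_smul_set_iff₀ hε.ne' _ _).2 hv⟩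
  · rintro ⟨ε, hε, hv⟩
    exact ⟨ε⁻¹, inv_pos.2 hε, (mem_smul_set_iff_inv_smul_mem₀ hε.ne' _ _).1 hv⟩

theorem sub_mem_tangentCone (ϑ : Fin n → ℝ) (hθ : θ ∈ Ω) : θ - ϑ ∈ tangentCone Ω ϑ :=
  subset_closure ⟨1, one_pos, by rwa [one_smul, add_sub_cancel]⟩

theorem Proj_spec (hΩ : Ω.Nonempty) (ϑ y : Fin n → ℝ) :
    Proj Ω ϑ y ∈ tangentCone Ω ϑ ∧ ∀ w ∈ tangentCone Ω ϑ,
      (y - Proj Ω ϑ y) ⬝ᵥ (y - Proj Ω ϑ y) ≤ (y - w) ⬝ᵥ (y - w) := by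
  obtain ⟨θ, hθ⟩ := hΩ
  exact Classical.epsilon_spec
    (exists_forall_sub_dotProduct_sub_le isClosed_closure ⟨_, sub_mem_tangentCone ϑ hθ⟩ y)

theorem sub_dotProduct_Proj_le (hΩ : Convex ℝ Ω) (hθ : θ ∈ Ω) (ϑ y : Fin n → ℝ) :
    (ϑ - θ) ⬝ᵥ Proj Ω ϑ y ≤ (ϑ - θ) ⬝ᵥ y := by
  obtain ⟨hmem, hmin⟩ := Proj_spec ⟨θ, hθ⟩ ϑ y
  have hdir := sub_mem_tangentCone ϑ hθ
  have hvar : (y - Proj Ω ϑ y) ⬝ᵥ (θ - ϑ) ≤ 0 := by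
    refine sub_dotProduct_nonpos_of_forall_sub_dotProduct_sub_le fun s hs => hmin _ ?_
    rw [tangentCone_eq_closure_hull hΩ] at hmem hdir ⊢
    exact ConvexCone.add_mem _ hmem (ConvexCone.smul_mem _ hs hdir)
  rw [dotProduct_comm, ← neg_sub ϑ θ, neg_dotProduct, dotProduct_sub] at hvar
  linarith

end TangentConeProjection

section SquareIntegrableSignals

theorem integrableOn_Ioi_of_intervalIntegral_le {f : ℝ → ℝ} {B : ℝ} (hf : ContinuousOn f (Ici 0))
    (hnonneg : ∀ t, 0 ≤ t → 0 ≤ f t) (hB : ∀ t, 0 ≤ t → ∫ τ in (0 : ℝ)..t, f τ ≤ B) :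
    IntegrableOn f (Ioi 0) := by
  refine integrableOn_Ioi_of_intervalIntegral_norm_bounded B 0 (b := fun t : ℝ => t) (l := atTop)
    (fun t => ?_) tendsto_id ?_
  · exact ((hf.mono Icc_subset_Ici_self).integrableOn_Icc (b := t)).mono_set Ioc_subset_Icc_self
  · filter_upwards [eventually_ge_atTop 0] with t ht
    refine le_of_eq_of_le (intervalIntegral.integral_congr fun τ hτ => ?_) (hB t ht)
    rw [uIcc_of_le ht] at hτ
    exact Real.norm_of_nonneg (hnonneg τ hτ.1)

/- The hypotheses make both `φ³` and its derivative `3 φ² φ'` integrable. -/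
theorem tendsto_zero_of_integrableOn_sq {φ φ' : ℝ → ℝ}
    (hφ : ∀ t, 0 ≤ t → HasDerivWithinAt φ (φ' t) (Ici 0) t) (hφ' : ContinuousOn φ' (Ici 0))
    (hbdd : IsBoundedSignal φ) (hbdd' : IsBoundedSignal φ')
    (hint : IntegrableOn (fun t => φ t ^ 2) (Ioi 0)) : Tendsto φ atTop (𝓝 0) := by
  have integrableOn_mul_sq {ψ : ℝ → ℝ} (hψ : ContinuousOn ψ (Ici 0)) (hψb : IsBoundedSignal ψ) :
      IntegrableOn (fun t => ψ t * φ t ^ 2) (Ioi 0) := by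
    obtain ⟨M, hM⟩ := hψb
    exact hint.bdd_mul
      ((hψ.mono Ioi_subset_Ici_self).aestronglyMeasurable measurableSet_Ioi)
      ((ae_restrict_mem measurableSet_Ioi).mono fun t ht => hM t (le_of_lt ht))
  have hcube := integrableOn_mul_sq (fun t ht => (hφ t ht).continuousWithinAt) hbdd
  have hcube' := (integrableOn_mul_sq hφ' hbdd').const_mul 3
  have hderiv (t : ℝ) (ht : t ∈ Ioi (0 : ℝ)) :
      HasDerivAt (fun t => φ t * φ t ^ 2) (3 * (φ' t * φ t ^ 2)) t := by
    have hφt := (hφ t (le_of_lt ht)).hasDerivAt (Ici_mem_nhds ht)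
    refine (hφt.mul (hφt.pow 2)).congr_deriv ?_
    simp only [Pi.pow_apply]
    push_cast
    ring
  have hlim := tendsto_zero_of_hasDerivAt_of_integrableOn_Ioi hderiv hcube' hcube
  rw [Metric.tendsto_nhds] at hlim ⊢
  intro ε hε
  filter_upwards [hlim (ε ^ 3) (by positivity)] with t ht
  rw [Real.dist_eq, sub_zero] at ht ⊢
  rw [← pow_succ', abs_pow] at ht
  exact lt_of_pow_lt_pow_left₀ 3 hε.le ht

end SquareIntegrableSignals

section EnergyIdentities

variable {ι : Type*} [Fintype ι]

theorem continuousOn_dotProduct {f g : ℝ → ι → ℝ} {s : Set ℝ} (hf : ContinuousOn f s)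
    (hg : ContinuousOn g s) : ContinuousOn (fun t => f t ⬝ᵥ g t) s :=
  (by fun_prop : Continuous fun p : (ι → ℝ) × (ι → ℝ) => p.1 ⬝ᵥ p.2).comp_continuousOn
    (hf.prodMk hg)

theorem sq_add_integral {g : ℝ → ℝ} {z₀ a t : ℝ} (hg : IntervalIntegrable g volume a t) :
    (z₀ + ∫ τ in a..t, g τ) ^ 2 =
      z₀ ^ 2 + ∫ s in a..t, 2 * ((z₀ + ∫ τ in a..s, g τ) * g s) := by
  set z : ℝ → ℝ := fun s => z₀ + ∫ τ in a..s, g τ with hz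
  have hac : AbsolutelyContinuousOnInterval z a t :=
    contDiffOn_const.absolutelyContinuousOnInterval.add
      (hg.absolutelyContinuousOnInterval_intervalIntegral left_mem_uIcc)
  have hparts := hac.integral_deriv_mul_eq_sub hac
  have hderiv : ∫ s in a..t, 2 * (z s * g s) = ∫ s in a..t, deriv z s * z s + z s * deriv z s := by
    refine intervalIntegral.integral_congr_ae ?_
    filter_upwards [hg.ae_hasDerivAt_integral] with s hs hst
    rw [((hs (uIoc_subset_uIcc hst) a left_mem_uIcc).const_add z₀).deriv]
    ring
  have hza : z a = z₀ := by simp only [hz, intervalIntegral.integral_same, add_zero]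
  rw [hderiv, hparts, hza]
  ring

theorem intervalIntegrable_dotProduct {v w : ℝ → ι → ℝ} {a t : ℝ} (hw : ContinuousOn w (uIcc a t))
    (hv : IntervalIntegrable v volume a t) :
    IntervalIntegrable (fun s => w s ⬝ᵥ v s) volume a t := by
  have hvi (i : ι) : IntervalIntegrable (fun s => v s i) volume a t := ⟨hv.1.eval i, hv.2.eval i⟩
  have hsum := IntervalIntegrable.sum Finset.univ fun i _ =>
    (hvi i).continuousOn_mul ((continuous_apply i).comp_continuousOn hw)
  simpa only [Finset.sum_fn] using! hsum

theorem dotProduct_self_add_integral {v : ℝ → ι → ℝ} {z₀ : ι → ℝ} {a t : ℝ}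
    (hv : IntervalIntegrable v volume a t) :
    (z₀ + ∫ τ in a..t, v τ) ⬝ᵥ (z₀ + ∫ τ in a..t, v τ) =
      z₀ ⬝ᵥ z₀ + ∫ s in a..t, 2 * ((z₀ + ∫ τ in a..s, v τ) ⬝ᵥ v s) := by
  have integral_apply {s : ℝ} (hs : s ∈ uIcc a t) (i : ι) :
      (∫ τ in a..s, v τ) i = ∫ τ in a..s, v τ i :=
    ((ContinuousLinearMap.proj (R := ℝ) (φ := fun _ : ι => ℝ) i).intervalIntegral_comp_comm
      (hv.mono_set (uIcc_subset_uIcc_left hs))).symm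
  have hvi (i : ι) : IntervalIntegrable (fun s => v s i) volume a t := ⟨hv.1.eval i, hv.2.eval i⟩
  have hterm (i : ι) : IntervalIntegrable
      (fun s => 2 * ((z₀ i + ∫ τ in a..s, v τ i) * v s i)) volume a t :=
    ((hvi i).continuousOn_mul (continuousOn_const.add
      (intervalIntegral.continuousOn_primitive_interval' (hvi i) left_mem_uIcc))).const_mul 2
  calc (z₀ + ∫ τ in a..t, v τ) ⬝ᵥ (z₀ + ∫ τ in a..t, v τ)
    _ = ∑ i, (z₀ i ^ 2 + ∫ s in a..t, 2 * ((z₀ i + ∫ τ in a..s, v τ i) * v s i)) := by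
      simp only [← sq_add_integral (hvi _), dotProduct, Pi.add_apply, integral_apply right_mem_uIcc,
        ← sq]
    _ = z₀ ⬝ᵥ z₀ + ∫ s in a..t, ∑ i, 2 * ((z₀ i + ∫ τ in a..s, v τ i) * v s i) := by
      rw [Finset.sum_add_distrib, intervalIntegral.integral_finsetSum fun i _ => hterm i]
      simp only [dotProduct, sq]
    _ = z₀ ⬝ᵥ z₀ + ∫ s in a..t, 2 * ((z₀ + ∫ τ in a..s, v τ) ⬝ᵥ v s) := by
      congr 1
      refine intervalIntegral.integral_congr fun s hs => ?_
      simp only [dotProduct, Pi.add_apply, integral_apply hs, Finset.mul_sum]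

theorem lyapunov_energy_balance {A P Q : Matrix ι ι ℝ} {b : ι → ℝ} {x : ℝ → ι → ℝ} {f : ℝ → ℝ}
    {t : ℝ} (hPsymm : P.IsSymm) (hP : Aᵀ * P + P * A = -Q)
    (hx : ∀ t, 0 ≤ t → HasDerivWithinAt x (A *ᵥ x t + f t • b) (Ici 0) t)
    (hf : ContinuousOn f (Ici 0)) (ht : 0 ≤ t) :
    x t ⬝ᵥ (P *ᵥ x t) + ∫ τ in (0 : ℝ)..t, x τ ⬝ᵥ (Q *ᵥ x τ) =
      x 0 ⬝ᵥ (P *ᵥ x 0) + ∫ τ in (0 : ℝ)..t, 2 * (f τ * (x τ ⬝ᵥ (P *ᵥ b))) := by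
  have hxc : ContinuousOn x (Ici 0) := fun s hs => (hx s hs).continuousWithinAt
  have hderiv (s : ℝ) (hs : 0 ≤ s) : HasDerivWithinAt (fun τ => x τ ⬝ᵥ (P *ᵥ x τ))
      (2 * (f s * (x s ⬝ᵥ (P *ᵥ b))) - x s ⬝ᵥ (Q *ᵥ x s)) (Ici 0) s := by
    refine (hasDerivWithinAt_dotProduct (hx s hs)
      (hasDerivWithinAt_mulVec P (hx s hs))).congr_deriv ?_
    have hdiss := mulVec_dotProduct_mulVec_add A P (x s) (x s)
    rw [hP, Matrix.neg_mulVec, dotProduct_neg] at hdiss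
    rw [add_dotProduct, smul_dotProduct, Matrix.mulVec_add, dotProduct_add, Matrix.mulVec_smul,
      dotProduct_smul, dotProduct_mulVec_comm_of_isSymm hPsymm b, smul_eq_mul]
    linarith
  have hdissInt : IntervalIntegrable (fun τ => x τ ⬝ᵥ (Q *ᵥ x τ)) volume 0 t := by
    refine ((by fun_prop : Continuous fun v : ι → ℝ => v ⬝ᵥ (Q *ᵥ v)).comp_continuousOn
      (hxc.mono ?_)).intervalIntegrable
    rw [uIcc_of_le ht]
    exact Icc_subset_Ici_self
  have hsupplyInt : IntervalIntegrable (fun τ => 2 * (f τ * (x τ ⬝ᵥ (P *ᵥ b)))) volume 0 t := by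
    refine ((continuousOn_const.mul
      (hf.mul (continuousOn_dotProduct hxc continuousOn_const))).mono ?_).intervalIntegrable
    rw [uIcc_of_le ht]
    exact Icc_subset_Ici_self
  have hftc := intervalIntegral.integral_eq_sub_of_hasDerivAt_of_le ht
    (fun s hs => (hderiv s hs.1).continuousWithinAt.mono Icc_subset_Ici_self)
    (fun s hs => (hderiv s hs.1.le).hasDerivAt (Ici_mem_nhds hs.1)) (hsupplyInt.sub hdissInt)
  rw [intervalIntegral.integral_sub hsupplyInt hdissInt] at hftc
  linarith

theorem isBoundedSignal_of_dotProduct_mulVec_le {M : Matrix ι ι ℝ} (hM : M.PosDef)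
    {z : ℝ → ι → ℝ} {B : ℝ} (hB : ∀ t, 0 ≤ t → z t ⬝ᵥ (M *ᵥ z t) ≤ B) : IsBoundedSignal z := by
  obtain ⟨κ, hκ, hMκ⟩ := exists_pos_mul_norm_sq_le_of_posDef hM
  refine ⟨√(B / κ), fun t ht => Real.le_sqrt_of_sq_le ?_⟩
  rw [le_div_iff₀' hκ]
  exact (hMκ (z t)).trans (hB t ht)

theorem integrableOn_sq_apply_of_integral_dotProduct_mulVec_le {M : Matrix ι ι ℝ} (hM : M.PosDef)
    {z : ℝ → ι → ℝ} (hz : ContinuousOn z (Ici 0)) {B : ℝ}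
    (hB : ∀ t, 0 ≤ t → ∫ τ in (0 : ℝ)..t, z τ ⬝ᵥ (M *ᵥ z τ) ≤ B) (i : ι) :
    IntegrableOn (fun t => z t i ^ 2) (Ioi 0) := by
  obtain ⟨κ, hκ, hMκ⟩ := exists_pos_mul_norm_sq_le_of_posDef hM
  have hform : IntegrableOn (fun t => z t ⬝ᵥ (M *ᵥ z t)) (Ioi 0) :=
    integrableOn_Ioi_of_intervalIntegral_le
      ((by fun_prop : Continuous fun v : ι → ℝ => v ⬝ᵥ (M *ᵥ v)).comp_continuousOn hz)
      (fun t _ => le_trans (by positivity) (hMκ (z t))) hB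
  have hsq : ContinuousOn (fun t => z t i ^ 2) (Ioi 0) :=
    (((continuous_apply i).comp_continuousOn hz).pow 2).mono Ioi_subset_Ici_self
  refine (hform.const_mul κ⁻¹).mono' (hsq.aestronglyMeasurable measurableSet_Ioi)
    (Eventually.of_forall fun t => ?_)
  rw [Real.norm_of_nonneg (sq_nonneg _), le_inv_mul_iff₀ hκ, ← sq_abs]
  refine le_trans ?_ (hMκ (z t))
  gcongr
  exact norm_le_pi_norm (z t) i

end EnergyIdentities

section LoopForcing

variable {n : ℕ} {A : Matrix (Fin n) (Fin n) ℝ} {b x₀ : Fin n → ℝ} {C : ℂ → ℂ} {h q : ℝ → ℝ}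
  {e : ℝ → Fin n → ℝ}

/-- The signal that drives the loop `x = Ḡ (θᵀ x) + …`, namely the free response of the reference
model from `x₀`, plus the response of `H_o C` to the scaled reference `q`, minus the response of
`C` to the prediction error `e`. -/
noncomputable def loopForcing (A : Matrix (Fin n) (Fin n) ℝ) (b x₀ : Fin n → ℝ) (h q : ℝ → ℝ)
    (e : ℝ → Fin n → ℝ) (t : ℝ) (i : Fin n) : ℝ :=
  (transition A t *ᵥ x₀) i + causalConv (causalConv (hoKernel A b i) h) q t -
    causalConv h (fun τ => e τ i) t

theorem integral_causalConv_hoKernel (hA : IsHurwitz A) (b : Fin n → ℝ)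
    (hh : IsImpulseResponse h C) (hC0 : C 0 = 1) (i : Fin n) :
    ∫ t in Ioi (0 : ℝ), causalConv (hoKernel A b i) h t = Ho ℝ A b 0 i := by
  have hconv := integrableOn_causalConv (integrableOn_hoKernel hA b i) hh.1
  have hgbar := integral_gbarKernel hA b hh hC0 i
  simp only [gbarKernel] at hgbar
  rwa [integral_sub hconv (integrableOn_hoKernel hA b i), integral_hoKernel hA b i,
    sub_eq_zero] at hgbar

theorem isBoundedSignal_loopForcing (hA : IsHurwitz A) (hh : IntegrableOn h (Ioi 0))
    (hq : IsBoundedSignal q) (he : IsBoundedSignal e) :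
    IsBoundedSignal (loopForcing A b x₀ h q e) := by
  have hfree : IsBoundedSignal fun t => transition A t *ᵥ x₀ :=
    isBoundedSignal_of_tendsto (continuous_transition_mulVec A x₀).continuousOn
      (tendsto_transition_mulVec hA x₀)
  refine isBoundedSignal_pi.2 fun i => ?_
  exact ((isBoundedSignal_pi.1 hfree i).add
    (hq.causalConv (integrableOn_causalConv (integrableOn_hoKernel hA b i) hh))).sub
    ((isBoundedSignal_pi.1 he i).causalConv hh)

theorem tendsto_loopForcing (hA : IsHurwitz A) (hh : IsImpulseResponse h C) (hC0 : C 0 = 1)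
    (hq : ContinuousOn q (Ici 0)) {q' : ℝ} (hqlim : Tendsto q atTop (𝓝 q'))
    (he : ContinuousOn e (Ici 0)) (helim : Tendsto e atTop (𝓝 0)) :
    Tendsto (loopForcing A b x₀ h q e) atTop (𝓝 fun i => Ho ℝ A b 0 i * q') := by
  refine tendsto_pi_nhds.2 fun i => ?_
  have hfree := tendsto_pi_nhds.1 (tendsto_transition_mulVec hA x₀) i
  have href := tendsto_causalConv (integrableOn_causalConv (integrableOn_hoKernel hA b i) hh.1)
    hq hqlim
  have herror := tendsto_causalConv hh.1 ((continuous_apply i).comp_continuousOn he)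
    (tendsto_pi_nhds.1 helim i)
  have hlim := (hfree.add href).sub herror
  rwa [integral_causalConv_hoKernel hA b hh hC0 i, Pi.zero_apply, zero_add, mul_zero,
    sub_zero] at hlim

end LoopForcing

namespace IsClosedLoop

variable {n : ℕ} {A P Q : Matrix (Fin n) (Fin n) ℝ} {b c K θ x₀ θhat₀ : Fin n → ℝ}
  {Γc : ℝ} {C : ℂ → ℂ} {Ω : Set (Fin n → ℝ)} {h r u u₂ y : ℝ → ℝ} {x xhat θhat : ℝ → Fin n → ℝ}
  {t : ℝ}

theorem hasDerivWithinAt_state (H : IsClosedLoop A b c K P Γc C Ω θ x₀ θhat₀ r x xhat θhat u u₂ y)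
    (ht : 0 ≤ t) :
    HasDerivWithinAt x (closedMatrix A b K *ᵥ x t + (u₂ t - θ ⬝ᵥ x t) • b) (Ici 0) t := by
  refine (H.plant t ht).congr_deriv ?_
  rw [H.control t ht, closedMatrix, Matrix.sub_mulVec, Matrix.vecMulVec_mulVec]
  ext i
  simp only [Pi.add_apply, Pi.sub_apply, Pi.smul_apply, smul_eq_mul, MulOpposite.smul_eq_mul_unop,
    MulOpposite.unop_op]
  ring

theorem hasDerivWithinAt_error (H : IsClosedLoop A b c K P Γc C Ω θ x₀ θhat₀ r x xhat θhat u u₂ y)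
    (ht : 0 ≤ t) :
    HasDerivWithinAt (fun t => xhat t - x t)
      (closedMatrix A b K *ᵥ (xhat t - x t) + (-((θhat t - θ) ⬝ᵥ x t)) • b) (Ici 0) t := by
  refine ((H.predictor t ht).sub (H.hasDerivWithinAt_state ht)).congr_deriv ?_
  rw [Matrix.mulVec_sub, sub_dotProduct]
  ext i
  simp only [Pi.add_apply, Pi.sub_apply, Pi.smul_apply, smul_eq_mul]
  ring

theorem error_zero (H : IsClosedLoop A b c K P Γc C Ω θ x₀ θhat₀ r x xhat θhat u u₂ y) :
    xhat 0 - x 0 = 0 := by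
  rw [H.predictor_init, H.plant_init, sub_self]

theorem continuousOn_state (H : IsClosedLoop A b c K P Γc C Ω θ x₀ θhat₀ r x xhat θhat u u₂ y) :
    ContinuousOn x (Ici 0) :=
  fun t ht => (H.plant t ht).continuousWithinAt

theorem continuousOn_error (H : IsClosedLoop A b c K P Γc C Ω θ x₀ θhat₀ r x xhat θhat u u₂ y) :
    ContinuousOn (fun t => xhat t - x t) (Ici 0) :=
  fun _ ht => (H.hasDerivWithinAt_error ht).continuousWithinAt

theorem continuousOn_estimate
    (H : IsClosedLoop A b c K P Γc C Ω θ x₀ θhat₀ r x xhat θhat u u₂ y) :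
    ContinuousOn θhat (Ici 0) := by
  intro t (ht : 0 ≤ t)
  have ht₁ : 0 ≤ t + 1 := by positivity
  have hprimitive := intervalIntegral.continuousOn_primitive_interval'
    (H.adaptation_integrable (t + 1) ht₁) left_mem_uIcc
  rw [uIcc_of_le ht₁] at hprimitive
  have hIcc : ContinuousOn θhat (Icc 0 (t + 1)) :=
    (continuousOn_const.add hprimitive).congr fun τ hτ => H.adaptation τ hτ.1
  refine (hIcc t ⟨ht, le_add_of_nonneg_right zero_le_one⟩).mono_of_mem_nhdsWithin ?_
  rw [← Ici_inter_Iic]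
  exact inter_mem_nhdsWithin _ (Iic_mem_nhds (lt_add_one t))

theorem continuousOn_mismatch
    (H : IsClosedLoop A b c K P Γc C Ω θ x₀ θhat₀ r x xhat θhat u u₂ y) :
    ContinuousOn (fun t => (θhat t - θ) ⬝ᵥ x t) (Ici 0) :=
  continuousOn_dotProduct (H.continuousOn_estimate.sub continuousOn_const) H.continuousOn_state

theorem estimate_sub_dotProduct_self_le
    (H : IsClosedLoop A b c K P Γc C Ω θ x₀ θhat₀ r x xhat θhat u u₂ y) (hΓc : 0 ≤ Γc)
    (hΩc : Convex ℝ Ω) (hθ : θ ∈ Ω) (ht : 0 ≤ t) :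
    (θhat t - θ) ⬝ᵥ (θhat t - θ) ≤ (θhat₀ - θ) ⬝ᵥ (θhat₀ - θ) + Γc * ∫ τ in (0 : ℝ)..t,
      2 * (((θhat τ - θ) ⬝ᵥ x τ) * ((xhat τ - x τ) ⬝ᵥ (P *ᵥ b))) := by
  set p : ℝ → ℝ := fun τ => (xhat τ - x τ) ⬝ᵥ (P *ᵥ b)
  set v : ℝ → Fin n → ℝ := fun τ => Γc • Proj Ω (θhat τ) (p τ • x τ)
  have hsub (s : ℝ) (hs : 0 ≤ s) : θhat₀ - θ + ∫ τ in (0 : ℝ)..s, v τ = θhat s - θ := by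
    rw [H.adaptation s hs, sub_add_eq_add_sub]
  have hIcc : uIcc 0 t ⊆ Ici 0 := (uIcc_of_le ht).trans_subset Icc_subset_Ici_self
  have hvar (s : ℝ) : (θhat s - θ) ⬝ᵥ v s ≤ Γc * (((θhat s - θ) ⬝ᵥ x s) * p s) := by
    have hproj := sub_dotProduct_Proj_le hΩc hθ (θhat s) (p s • x s)
    rw [dotProduct_smul, smul_eq_mul, mul_comm (p s)] at hproj
    rw [dotProduct_smul, smul_eq_mul]
    exact mul_le_mul_of_nonneg_left hproj hΓc
  have henergy := dotProduct_self_add_integral (v := v) (z₀ := θhat₀ - θ)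
    (H.adaptation_integrable t ht)
  rw [hsub t ht] at henergy
  rw [henergy, ← intervalIntegral.integral_const_mul]
  gcongr 1
  refine (intervalIntegral.integral_congr fun s hs => ?_).trans_le
    (intervalIntegral.integral_mono_on (f := fun s => 2 * ((θhat s - θ) ⬝ᵥ v s)) ht ?_ ?_
      fun s _ => ?_)
  · simp only [hsub s (hIcc hs)]
  · exact (intervalIntegrable_dotProduct
      ((H.continuousOn_estimate.sub continuousOn_const).mono hIcc)
      (H.adaptation_integrable t ht)).const_mul 2
  · exact ContinuousOn.intervalIntegrable <| (continuousOn_const.mul (continuousOn_const.mul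
      (H.continuousOn_mismatch.mul
        (continuousOn_dotProduct H.continuousOn_error continuousOn_const)))).mono hIcc
  · linarith [hvar s]

theorem lyapunov_le (H : IsClosedLoop A b c K P Γc C Ω θ x₀ θhat₀ r x xhat θhat u u₂ y)
    (hPsymm : P.IsSymm) (hP : (closedMatrix A b K)ᵀ * P + P * closedMatrix A b K = -Q)
    (hΓc : 0 ≤ Γc) (hΩc : Convex ℝ Ω) (hθ : θ ∈ Ω) (ht : 0 ≤ t) :
    Γc * ((xhat t - x t) ⬝ᵥ (P *ᵥ (xhat t - x t)) +
        ∫ τ in (0 : ℝ)..t, (xhat τ - x τ) ⬝ᵥ (Q *ᵥ (xhat τ - x τ))) +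
      (θhat t - θ) ⬝ᵥ (θhat t - θ) ≤ (θhat₀ - θ) ⬝ᵥ (θhat₀ - θ) := by
  have herror := lyapunov_energy_balance hPsymm hP (fun s hs => H.hasDerivWithinAt_error hs)
    H.continuousOn_mismatch.neg ht
  simp only [H.error_zero, zero_dotProduct, zero_add, neg_mul, mul_neg,
    intervalIntegral.integral_neg] at herror
  rw [herror, mul_neg]
  linarith [H.estimate_sub_dotProduct_self_le hΓc hΩc hθ ht]

theorem lyapunov_terms_le (H : IsClosedLoop A b c K P Γc C Ω θ x₀ θhat₀ r x xhat θhat u u₂ y)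
    (hPpos : P.PosDef) (hQ : Q.PosDef)
    (hP : (closedMatrix A b K)ᵀ * P + P * closedMatrix A b K = -Q)
    (hΓc : 0 < Γc) (hΩc : Convex ℝ Ω) (hθ : θ ∈ Ω) (ht : 0 ≤ t) :
    (xhat t - x t) ⬝ᵥ (P *ᵥ (xhat t - x t)) ≤ (θhat₀ - θ) ⬝ᵥ (θhat₀ - θ) / Γc ∧
      ∫ τ in (0 : ℝ)..t, (xhat τ - x τ) ⬝ᵥ (Q *ᵥ (xhat τ - x τ)) ≤
        (θhat₀ - θ) ⬝ᵥ (θhat₀ - θ) / Γc ∧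
      (θhat t - θ) ⬝ᵥ (θhat t - θ) ≤ (θhat₀ - θ) ⬝ᵥ (θhat₀ - θ) := by
  have hlyap := H.lyapunov_le ((Matrix.conjTranspose_eq_transpose_of_trivial P).symm.trans hPpos.1)
    hP hΓc.le hΩc hθ ht
  have herror : 0 ≤ (xhat t - x t) ⬝ᵥ (P *ᵥ (xhat t - x t)) :=
    hPpos.posSemidef.dotProduct_mulVec_nonneg _
  have hdiss : 0 ≤ ∫ τ in (0 : ℝ)..t, (xhat τ - x τ) ⬝ᵥ (Q *ᵥ (xhat τ - x τ)) :=
    intervalIntegral.integral_nonneg ht fun τ _ => hQ.posSemidef.dotProduct_mulVec_nonneg _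
  have hestimate : 0 ≤ (θhat t - θ) ⬝ᵥ (θhat t - θ) :=
    Finset.sum_nonneg fun i _ => mul_self_nonneg _
  rw [le_div_iff₀' hΓc, le_div_iff₀' hΓc]
  refine ⟨?_, ?_, ?_⟩ <;> nlinarith

theorem isBoundedSignal_error
    (H : IsClosedLoop A b c K P Γc C Ω θ x₀ θhat₀ r x xhat θhat u u₂ y)
    (hPpos : P.PosDef) (hQ : Q.PosDef)
    (hP : (closedMatrix A b K)ᵀ * P + P * closedMatrix A b K = -Q)
    (hΓc : 0 < Γc) (hΩc : Convex ℝ Ω) (hθ : θ ∈ Ω) : IsBoundedSignal fun t => xhat t - x t :=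
  isBoundedSignal_of_dotProduct_mulVec_le hPpos fun _ ht =>
    (H.lyapunov_terms_le hPpos hQ hP hΓc hΩc hθ ht).1

theorem integrableOn_sq_error
    (H : IsClosedLoop A b c K P Γc C Ω θ x₀ θhat₀ r x xhat θhat u u₂ y)
    (hPpos : P.PosDef) (hQ : Q.PosDef)
    (hP : (closedMatrix A b K)ᵀ * P + P * closedMatrix A b K = -Q)
    (hΓc : 0 < Γc) (hΩc : Convex ℝ Ω) (hθ : θ ∈ Ω) (i : Fin n) :
    IntegrableOn (fun t => (xhat t - x t) i ^ 2) (Ioi 0) :=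
  integrableOn_sq_apply_of_integral_dotProduct_mulVec_le hQ H.continuousOn_error
    (fun _ ht => (H.lyapunov_terms_le hPpos hQ hP hΓc hΩc hθ ht).2.1) i

theorem isBoundedSignal_estimate_sub
    (H : IsClosedLoop A b c K P Γc C Ω θ x₀ θhat₀ r x xhat θhat u u₂ y)
    (hPpos : P.PosDef) (hQ : Q.PosDef)
    (hP : (closedMatrix A b K)ᵀ * P + P * closedMatrix A b K = -Q)
    (hΓc : 0 < Γc) (hΩc : Convex ℝ Ω) (hθ : θ ∈ Ω) : IsBoundedSignal fun t => θhat t - θ := by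
  refine isBoundedSignal_of_dotProduct_mulVec_le Matrix.PosDef.one
    (B := (θhat₀ - θ) ⬝ᵥ (θhat₀ - θ)) fun t ht => ?_
  rw [Matrix.one_mulVec]
  exact (H.lyapunov_terms_le hPpos hQ hP hΓc hΩc hθ ht).2.2

theorem tendsto_error (H : IsClosedLoop A b c K P Γc C Ω θ x₀ θhat₀ r x xhat θhat u u₂ y)
    (hPpos : P.PosDef) (hQ : Q.PosDef)
    (hP : (closedMatrix A b K)ᵀ * P + P * closedMatrix A b K = -Q)
    (hΓc : 0 < Γc) (hΩc : Convex ℝ Ω) (hθ : θ ∈ Ω) (hx : IsBoundedSignal x) :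
    Tendsto (fun t => xhat t - x t) atTop (𝓝 0) := by
  refine tendsto_pi_nhds.2 fun i => ?_
  set velocity : (Fin n → ℝ) × (Fin n → ℝ) × (Fin n → ℝ) → ℝ := fun p =>
    (closedMatrix A b K *ᵥ p.1 + (-(p.2.1 ⬝ᵥ p.2.2)) • b) i
  have hvelocity : Continuous velocity := by fun_prop
  have hbdd := H.isBoundedSignal_error hPpos hQ hP hΓc hΩc hθ
  exact tendsto_zero_of_integrableOn_sq
    (φ' := fun t => velocity (xhat t - x t, θhat t - θ, x t))
    (fun t ht => hasDerivWithinAt_pi.1 (H.hasDerivWithinAt_error ht) i)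
    (hvelocity.comp_continuousOn (H.continuousOn_error.prodMk
      ((H.continuousOn_estimate.sub continuousOn_const).prodMk H.continuousOn_state)))
    (isBoundedSignal_pi.1 hbdd i)
    ((hbdd.prodMk ((H.isBoundedSignal_estimate_sub hPpos hQ hP hΓc hΩc hθ).prodMk
      hx)).continuous_comp hvelocity)
    (H.integrableOn_sq_error hPpos hQ hP hΓc hΩc hθ i)

theorem causalConv_mismatch (H : IsClosedLoop A b c K P Γc C Ω θ x₀ θhat₀ r x xhat θhat u u₂ y)
    (ht : 0 ≤ t) (i : Fin n) :
    causalConv (hoKernel (closedMatrix A b K) b i) (fun τ => (θhat τ - θ) ⬝ᵥ x τ) t =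
      -(xhat t - x t) i := by
  have hvoc := variation_of_constants (fun t ht => H.hasDerivWithinAt_error ht)
    H.continuousOn_mismatch.neg ht i
  rw [causalConv_neg, H.error_zero, Matrix.mulVec_zero, Pi.zero_apply, zero_add] at hvoc
  rw [hvoc, neg_neg]

theorem causalConv_causalConv_mismatch
    (H : IsClosedLoop A b c K P Γc C Ω θ x₀ θhat₀ r x xhat θhat u u₂ y)
    (hA : IsHurwitz (closedMatrix A b K)) (hh : IntegrableOn h (Ioi 0)) (ht : 0 ≤ t) (i : Fin n) :
    causalConv (causalConv (hoKernel (closedMatrix A b K) b i) h)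
      (fun τ => (θhat τ - θ) ⬝ᵥ x τ) t = -causalConv h (fun τ => (xhat τ - x τ) i) t := by
  rw [causalConv_comm _ h, causalConv_assoc hh (integrableOn_hoKernel hA b i)
    H.continuousOn_mismatch ht, ← causalConv_neg]
  exact causalConv_congr ht fun τ hτ => H.causalConv_mismatch hτ.1 i

theorem state_eq (H : IsClosedLoop A b c K P Γc C Ω θ x₀ θhat₀ r x xhat θhat u u₂ y)
    (hA : IsHurwitz (closedMatrix A b K)) (hh : IntegrableOn h (Ioi 0))
    (hu₂ : ∀ t, 0 ≤ t → u₂ t =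
      causalConv h (fun τ => θhat τ ⬝ᵥ x τ + kg (closedMatrix A b K) b c * r τ) t)
    (hr : ContinuousOn r (Ici 0)) (ht : 0 ≤ t) (i : Fin n) :
    x t i = causalConv (gbarKernel (closedMatrix A b K) b h i) (fun τ => θ ⬝ᵥ x τ) t +
      loopForcing (closedMatrix A b K) b x₀ h (fun τ => kg (closedMatrix A b K) b c * r τ)
        (fun τ => xhat τ - x τ) t i := by
  set ho := hoKernel (closedMatrix A b K) b i
  set q : ℝ → ℝ := fun τ => kg (closedMatrix A b K) b c * r τ
  have hho : IntegrableOn ho (Ioi 0) := integrableOn_hoKernel hA b i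
  have hconv : IntegrableOn (causalConv ho h) (Ioi 0) := integrableOn_causalConv hho hh
  have hq : ContinuousOn q (Ici 0) := continuousOn_const.mul hr
  have hθx : ContinuousOn (fun τ => θ ⬝ᵥ x τ) (Ici 0) :=
    continuousOn_dotProduct continuousOn_const H.continuousOn_state
  have hinput (τ : ℝ) : θhat τ ⬝ᵥ x τ + q τ = θ ⬝ᵥ x τ + q τ + (θhat τ - θ) ⬝ᵥ x τ := by
    rw [sub_dotProduct]
    ring
  rw [funext hinput] at hu₂
  have hθxq : ContinuousOn (fun τ => θ ⬝ᵥ x τ + q τ) (Ici 0) := hθx.add hq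
  have hinputc : ContinuousOn (fun τ => θ ⬝ᵥ x τ + q τ + (θhat τ - θ) ⬝ᵥ x τ) (Ici 0) :=
    hθxq.add H.continuousOn_mismatch
  have hu₂c : ContinuousOn u₂ (Ici 0) := (continuousOn_causalConv hh hinputc).congr hu₂
  have hfiltered : causalConv ho u₂ t = causalConv (causalConv ho h) (fun τ => θ ⬝ᵥ x τ) t +
      causalConv (causalConv ho h) q t - causalConv h (fun τ => (xhat τ - x τ) i) t := by
    rw [causalConv_congr ht fun τ hτ => hu₂ τ hτ.1, ← causalConv_assoc hho hh hinputc ht,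
      causalConv_add hconv hθxq H.continuousOn_mismatch ht,
      causalConv_add hconv hθx hq ht,
      H.causalConv_causalConv_mismatch hA hh ht, sub_eq_add_neg]
  have hvoc := variation_of_constants (fun t ht => H.hasDerivWithinAt_state ht) (hu₂c.sub hθx) ht i
  rw [H.plant_init, causalConv_sub hho hu₂c hθx ht, hfiltered] at hvoc
  have hloop : causalConv (gbarKernel (closedMatrix A b K) b h i) (fun τ => θ ⬝ᵥ x τ) t =
      causalConv (causalConv ho h) (fun τ => θ ⬝ᵥ x τ) t -
        causalConv ho (fun τ => θ ⬝ᵥ x τ) t :=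
    causalConv_sub_left hconv hho hθx ht
  rw [hvoc, hloop, loopForcing]
  ring

end IsClosedLoop

theorem ofReal_sum_abs_le_thetaMax {n : ℕ} {Ω : Set (Fin n → ℝ)} {θ : Fin n → ℝ} (hθ : θ ∈ Ω) :
    ENNReal.ofReal (∑ i, |θ i|) ≤ thetaMax Ω := by
  rw [ENNReal.ofReal_sum_of_nonneg fun i _ => abs_nonneg (θ i)]
  exact le_iSup₂ (f := fun ϑ (_ : ϑ ∈ Ω) => ∑ i, ENNReal.ofReal |ϑ i|) θ hθ

theorem dotProduct_Ho_mul_kg {n : ℕ} {Am : Matrix (Fin n) (Fin n) ℝ} {b c : Fin n → ℝ}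
    (hkg : c ⬝ᵥ Ho ℝ Am b 0 ≠ 0) (ρ : ℝ) :
    (c ⬝ᵥ fun i => Ho ℝ Am b 0 i * (kg Am b c * ρ)) = ρ := by
  have hsmul : (fun i => Ho ℝ Am b 0 i * (kg Am b c * ρ)) = (kg Am b c * ρ) • Ho ℝ Am b 0 :=
    funext fun i => mul_comm _ _
  rw [hsmul, dotProduct_smul, smul_eq_mul, kg]
  field_simp

end L1Adaptive

theorem mainTheorem11_general {n : ℕ}
    (A : Matrix (Fin n) (Fin n) ℝ) (b c K : Fin n → ℝ)
    (hAm : L1Adaptive.IsHurwitz (L1Adaptive.closedMatrix A b K))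
    (hkg : c ⬝ᵥ L1Adaptive.Ho ℝ (L1Adaptive.closedMatrix A b K) b 0 ≠ 0)
    (P Q : Matrix (Fin n) (Fin n) ℝ) (hQ : Q.PosDef)
    (hP : (L1Adaptive.closedMatrix A b K)ᵀ * P + P * L1Adaptive.closedMatrix A b K = -Q)
    (Γc : ℝ) (hΓc : 0 < Γc)
    (C : ℂ → ℂ) (hC0 : C 0 = 1)
    (Ω : Set (Fin n → ℝ)) (hΩc : Convex ℝ Ω)
    (θ : Fin n → ℝ) (hθ : θ ∈ Ω)
    (hgain : L1Adaptive.l1GainVec (L1Adaptive.Gbar (L1Adaptive.closedMatrix A b K) b C) *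
      ENNReal.ofReal (∑ i, |θ i|) < 1)
    (x₀ θhat₀ : Fin n → ℝ)
    (r : ℝ → ℝ) (hr : ContinuousOn r (Set.Ici 0)) (rlim : ℝ)
    (hrlim : Filter.Tendsto r Filter.atTop (nhds rlim))
    (x xhat θhat : ℝ → Fin n → ℝ) (u u₂ y : ℝ → ℝ)
    (hloop : L1Adaptive.IsClosedLoop A b c K P Γc C Ω θ x₀ θhat₀ r x xhat θhat u u₂ y) :
    Filter.Tendsto y Filter.atTop (nhds rlim) := by
  open L1Adaptive MeasureTheory Set Filter Topology in
  obtain ⟨h, hh, hu₂⟩ := hloop.filter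
  set Am := closedMatrix A b K
  set q : ℝ → ℝ := fun t => kg Am b c * r t
  have hg (i : Fin n) := isImpulseResponse_gbarKernel hAm b hh i
  have hsmall := l1Norm_mul_lt_one_of_l1GainVec_mul_lt_one hg hgain
  have hstate := fun t ht => hloop.state_eq hAm hh.1 hu₂ hr (t := t) ht
  have hPpos := posDef_of_lyapunov hAm hQ hP
  have hqc : ContinuousOn q (Ici 0) := continuousOn_const.mul hr
  have hq : Tendsto q atTop (𝓝 (kg Am b c * rlim)) := hrlim.const_mul _
  have hxbdd : IsBoundedSignal x := isBoundedSignal_of_small_gain (fun i => (hg i).1) hsmall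
    hloop.continuousOn_state hstate (isBoundedSignal_loopForcing hAm hh.1
      (isBoundedSignal_of_tendsto hqc hq) (hloop.isBoundedSignal_error hPpos hQ hP hΓc hΩc hθ))
  have herror := hloop.tendsto_error hPpos hQ hP hΓc hΩc hθ hxbdd
  have hx : Tendsto x atTop (𝓝 fun i => Ho ℝ Am b 0 i * (kg Am b c * rlim)) :=
    tendsto_of_small_gain (fun i => (hg i).1) (integral_gbarKernel hAm b hh hC0) hsmall
      hloop.continuousOn_state hstate hxbdd
      (tendsto_loopForcing hAm hh hC0 hqc hq hloop.continuousOn_error herror)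
  have hy := ((by fun_prop : Continuous fun v => c ⬝ᵥ v).tendsto _).comp hx
  rw [dotProduct_Ho_mul_kg hkg] at hy
  exact hy.congr' ((eventually_ge_atTop 0).mono fun t ht => (hloop.output t ht).symm)

theorem mainTheorem11 {n : ℕ}
    (A : Matrix (Fin n) (Fin n) ℝ) (b c K : Fin n → ℝ)
    (hAm : L1Adaptive.IsHurwitz (L1Adaptive.closedMatrix A b K))
    (hkg : c ⬝ᵥ L1Adaptive.Ho ℝ (L1Adaptive.closedMatrix A b K) b 0 ≠ 0)
    (P Q : Matrix (Fin n) (Fin n) ℝ) (hQ : Q.PosDef)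
    (hP : (L1Adaptive.closedMatrix A b K)ᵀ * P + P * L1Adaptive.closedMatrix A b K = -Q)
    (Γc : ℝ) (hΓc : 0 < Γc)
    (C : ℂ → ℂ) (hC : L1Adaptive.IsStableStrictlyProper C) (hC0 : C 0 = 1)
    (Ω : Set (Fin n → ℝ)) (hΩ : IsCompact Ω) (hΩc : Convex ℝ Ω)
    (hgain : L1Adaptive.l1GainVec (L1Adaptive.Gbar (L1Adaptive.closedMatrix A b K) b C) *
      L1Adaptive.thetaMax Ω < 1)
    (θ : Fin n → ℝ) (hθ : θ ∈ Ω)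
    (x₀ θhat₀ : Fin n → ℝ) (hθhat₀ : θhat₀ ∈ Ω)
    (r : ℝ)
    (x xhat θhat : ℝ → Fin n → ℝ) (u u₂ y : ℝ → ℝ)
    (hloop : L1Adaptive.IsClosedLoop A b c K P Γc C Ω θ x₀ θhat₀ (fun _ => r)
      x xhat θhat u u₂ y) :
    Filter.Tendsto y Filter.atTop (nhds r) :=
  mainTheorem11_general A b c K hAm hkg P Q hQ hP Γc hΓc C hC0 Ω hΩc θ hθ
    ((mul_le_mul_right (L1Adaptive.ofReal_sum_abs_le_thetaMax hθ) _).trans_lt hgain) x₀ θhat₀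
    (fun _ => r) continuousOn_const r tendsto_const_nhds x xhat θhat u u₂ y hloop
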